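/- Let $\mathbb M=\mathbb R^d$ and let $\mathcal P_2(\mathbb M)$ be the space of Borel probability measures on $\mathbb M$ with finite second moment, with the Wasserstein metric $W_2$. Let $\Gamma_0(m,\nu)$ be the set of couplings of $m,\nu$ that are optimal for the quadratic cost. **Definitions.** Let $U:\mathcal P_2(\mathbb M)\to\mathbb R$. A field $\zeta\in L^2(m)=L^2(\mathbb M,m;\mathbb R^d)$ is a subgradient of $U$ at $m$ if, as $\nu\to m$, $U[\nu]-U[m]\ge\inf_{\gamma\in\Gamma_0(m,\nu)}\int\zeta(x)\cdot(y-x)\,\gamma(dx,dy)+o(W_2(m,\nu))$; it is a supergradient of $U$ if $-\zeta$ is a subgradient of $-U$. $U$ is differentiable at $m$ if it has both a subgradient and a supergradient at $m$, and then $\nabla_wU[m]$ is the subgradient of minimal norm in $L^2(m)$. Let $T_m$ be the closure of $\nabla C_c^\infty(\mathbb M)$ in $L^2(m)$ and $\pi_m$ the orthogonal projection of $L^2(m)$ onto $T_m$. For matrix fields $\tilde A:\mathbb M\to\mathbb R^{d\times d}$, $A:\mathbb M^2\to\mathbb R^{d\times d}$ put $$P_\gamma^{\tilde A,A}(x,y)=\tilde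 A(x)(y-x)+\int_{\mathbb M^2}A(x,a)(b-a)\,\gamma(da,db).$$ $U$ is twice differentiable at $m$ if on a neighbourhood $V$ of $m$ it is differentiable, with $\nabla_wU[\nu]$ ($\nu\in V$) represented by continuous functions satisfying $|\nabla_wU[\nu](x)|\le C(1+|x|)$ with $C$ independent of $\nu\in V$, and there are bounded Borel fields $\tilde A[m]$, $A_{mm}$, a concave modulus $\rho$ and a function $\epsilon_2\ge0$ with $\epsilon_2(t)\to0$ as $t\to0^+$, such that for all $\nu\in V$, $\gamma\in\Gamma_0(m,\nu)$, $x,y\in\mathbb M$, $$\bigl|\nabla_wU[\nu](y)-\nabla_wU[m](x)-P^{\tilde A[m],A_{mm}}_\gamma(x,y)\bigr|\le|x-y|\rho(|x-y|)+W_2(m,\nu)\,\epsilon_2(W_2(m,\nu)).$$ (Here a concave modulus is a continuous, nondecreasing, subadditive, concave $\rho:[0,\infty)\to[0,\infty)$ with $\rho(0)=0$.) Then $\tilde A[m]=\nabla(\nabla_wU[m])$ is the spatial gradient, and $\nabla_w^2U[m]:=\pi_m(A_{mm})$, where for each $x$ the rows of $a\mapsto A_{mm}(x,a)$ are projected onto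 $T_m$. $U$ is twice continuously differentiable on an open set $\mathcal O$ if it is twice differentiable at every $m\in\mathcal O$ and $(x,m)\mapsto\tilde A[m](x)$ and $(x,y,m)\mapsto\nabla^2_wU[m](x,y)$ are continuous on $\mathbb M\times\mathcal O$ and $\mathbb M^2\times\mathcal O$. Gradients and second order gradients are identified with chosen everywhere defined versions. **Theorem.** Let $\mathcal O\subset\mathcal P_2(\mathbb M)$ be an open $W_2$-ball centred at $\mu$. Let $G_N:\mathcal P_2(\mathbb M)\to\mathbb R$ be continuous functions converging uniformly to $G$, each twice differentiable at every point of $\mathcal O$, such that: 1. for $m\in\mathcal O$, $\nabla_wG_N[m]$ is $C^1$ on $\mathbb M$, and $|\nabla_wG_N[m](x)|\le C_\mu(1+|x|)$ for all $N$, $x\in\mathbb M$, $m\in\mathcal O$; 2. $(x,m)\mapsto\nabla(\nabla_wG_N)[m](x)$ is continuous and bounded on $\mathbb M\times\mathcal O$ for each $N$, and $(x,y,m)\mapsto\nabla_w^2G_N[m](x,y)$ is continuous on $\mathbb M^2\times\mathcal O$ and bounded there independently of $N$; 3. for every $m\in\mathcal O$ there is a constant $C_m$, independent of $N$ and $\nu$,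 such that for all $N$, $\nu\in\mathcal O$, $\gamma\in\Gamma_0(m,\nu)$ and $x,y\in\mathbb M$, $$\Bigl|G_N[\nu]-G_N[m]-\int_{\mathbb M^2}\nabla_wG_N[m](x)\cdot(y-x)\,\gamma(dx,dy)\Bigr|\le C_mW_2^2(m,\nu),$$ $$\Bigl|\nabla_wG_N[\nu](y)-\nabla_wG_N[m](x)-P_\gamma^{\nabla(\nabla_wG_N)[m],\,\nabla_w^2G_N[m]}(x,y)\Bigr|\le C_m\bigl(|x-y|^2+W_2^2(m,\nu)\bigr);$$ 4. as $N\to\infty$, $\nabla_wG_N[m](x)\to A_m(x)$ and $\nabla(\nabla_wG_N)[m](x)\to\tilde A[m](x)$ uniformly on $\mathbb M\times\mathcal O$, and $\nabla_w^2G_N[m](x,y)\to A_{mm}(x,y)$ uniformly on $\mathbb M^2\times\mathcal O$. Then (i) $G$ is differentiable at every $m\in\mathcal O$, and $\nabla_wG[m]=A_m$; (ii) $G$ is twice continuously differentiable on $\mathcal O$, with $\tilde A[m]=\nabla(\nabla_wG)[m]$ and $A_{mm}=\nabla_w^2G[m]$ for every $m\in\mathcal O$; moreover the expansion in the definition of twice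 differentiability of $G$ at $m$ holds with $V=\mathcal O$ and the coefficients $\tilde A[m]$, $A_{mm}$ themselves. -/

import Mathlib

open MeasureTheory Filter Topology Set
open scoped ENNReal ContDiff

noncomputable section

namespace Wass

/-- The Euclidean space `ℝ^d`. -/
abbrev E (d : ℕ) : Type := EuclideanSpace ℝ (Fin d)

/-- Borel probability measures on `ℝ^d` with finite second moment. -/
structure P2 (d : ℕ) where
  /-- the underlying measure -/
  meas : Measure (E d)
  isProb : IsProbabilityMeasure meas
  secondMoment : ∫⁻ x, ‖x‖ₑ ^ 2 ∂meas < ⊤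

instance {d : ℕ} (m : P2 d) : IsProbabilityMeasure m.meas := m.isProb

/-- `Γ(m, ν)`: the measures on `ℝ^d × ℝ^d` with first marginal `m` and second marginal `ν`. -/
def couplings {d : ℕ} (m ν : P2 d) : Set (Measure (E d × E d)) :=
  {γ | γ.fst = m.meas ∧ γ.snd = ν.meas}

/-- The quadratic transport cost `∫ |x - y|² γ(dx, dy)`. -/
def cost {d : ℕ} (γ : Measure (E d × E d)) : ℝ≥0∞ := ∫⁻ p, ‖p.1 - p.2‖ₑ ^ 2 ∂γ

/-- The Wasserstein distance `W₂`. -/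
def W2 {d : ℕ} (m ν : P2 d) : ℝ := √(⨅ γ ∈ couplings m ν, cost γ).toReal

/-- `Γ₀(m, ν)`: the couplings that realize `W₂(m, ν)`. -/
def optCouplings {d : ℕ} (m ν : P2 d) : Set (Measure (E d × E d)) :=
  {γ | γ ∈ couplings m ν ∧ cost γ = ENNReal.ofReal (W2 m ν ^ 2)}

/-- The open ball of `(P₂(ℝ^d), W₂)` with centre `m` and radius `r`. -/
def ball {d : ℕ} (m : P2 d) (r : ℝ) : Set (P2 d) := {ν | W2 m ν < r}

/-- The topology of the metric `W₂`, generated by its open balls. -/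
instance {d : ℕ} : TopologicalSpace (P2 d) :=
  TopologicalSpace.generateFrom {s | ∃ m r, s = ball m r}

/-- `∫ ζ(x) · (y - x) γ(dx, dy)`. -/
def pairing {d : ℕ} (ζ : E d → E d) (γ : Measure (E d × E d)) : ℝ :=
  ∫ p, inner ℝ (ζ p.1) (p.2 - p.1) ∂γ

/-- The subgradients of `U` at `m`: the `ζ ∈ L²(m)` such that, as `ν → m`,
`U[ν] - U[m] ≥ inf_{γ ∈ Γ₀(m, ν)} ∫ ζ(x) · (y - x) γ(dx, dy) + o(W₂(m, ν))`. -/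
def subgradients {d : ℕ} (U : P2 d → ℝ) (m : P2 d) : Set (E d → E d) :=
  {ζ | MemLp ζ 2 m.meas ∧ ∀ ε : ℝ, 0 < ε → ∀ᶠ ν in 𝓝 m,
    sInf (pairing ζ '' optCouplings m ν) - ε * W2 m ν ≤ U ν - U m}

/-- The supergradients of `U` at `m`. -/
def supergradients {d : ℕ} (U : P2 d → ℝ) (m : P2 d) : Set (E d → E d) :=
  {ζ | -ζ ∈ subgradients (-U) m}

/-- `U` is differentiable at `m`. -/
def DiffAt {d : ℕ} (U : P2 d → ℝ) (m : P2 d) : Prop :=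
  (subgradients U m).Nonempty ∧ (supergradients U m).Nonempty

/-- `U` is differentiable at `m` and `ζ` is a version of its Wasserstein gradient `∇_w U[m]`,
the subgradient of minimal norm in `L²(m)`. -/
def HasGradAt {d : ℕ} (U : P2 d → ℝ) (m : P2 d) (ζ : E d → E d) : Prop :=
  DiffAt U m ∧ ζ ∈ subgradients U m ∧
    ∀ ξ ∈ subgradients U m, eLpNorm ζ 2 m.meas ≤ eLpNorm ξ 2 m.meas

/-- The tangent space `T_m P₂(ℝ^d)`: the closure in `L²(m)` of the (linear) set of the gradients
of smooth compactly supported functions. -/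
def tangentSpace {d : ℕ} (m : P2 d) : Submodule ℝ (Lp (E d) 2 m.meas) :=
  (Submodule.span ℝ {f : Lp (E d) 2 m.meas | ∃ φ : E d → ℝ,
    ContDiff ℝ ∞ φ ∧ HasCompactSupport φ ∧ f =ᵐ[m.meas] gradient φ}).topologicalClosure

/-- The orthogonal projection `π_m` of `L²(m)` onto the tangent space. -/
def tangentProj {d : ℕ} (m : P2 d) : Lp (E d) 2 m.meas →L[ℝ] Lp (E d) 2 m.meas :=
  haveI : CompleteSpace (tangentSpace m) := by unfold tangentSpace; infer_instance
  (tangentSpace m).starProjection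

/-- The `i`-th row of the matrix of `T`. -/
def row {d : ℕ} (T : E d →L[ℝ] E d) (i : Fin d) : E d :=
  ContinuousLinearMap.adjoint T (EuclideanSpace.single i 1)

/-- `B` is a version of `π_m(A)`, that is, for each `x` the rows of `a ↦ B(x, a)` are the
projections onto the tangent space of the rows of `a ↦ A(x, a)`. -/
def IsTangentProj {d : ℕ} (m : P2 d) (A B : E d → E d → E d →L[ℝ] E d) : Prop :=
  ∀ (x : E d) (i : Fin d), ∃ h : MemLp (fun a => row (A x a) i) 2 m.meas,
    tangentProj m (h.toLp (fun a => row (A x a) i)) =ᵐ[m.meas] fun a => row (B x a) i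

/-- `P_γ(x, y) = Ã(x)(y - x) + ∫ A(x, a)(b - a) γ(da, db)`. -/
def linPart {d : ℕ} (At : E d → E d →L[ℝ] E d) (A : E d → E d → E d →L[ℝ] E d)
    (γ : Measure (E d × E d)) (x y : E d) : E d :=
  At x (y - x) + ∫ p, A x p.1 (p.2 - p.1) ∂γ

/-- A concave modulus on `[0, ∞)`. -/
structure IsConcaveModulus (ρ : ℝ → ℝ) : Prop where
  nonneg : ∀ t, 0 ≤ t → 0 ≤ ρ t
  cont : ContinuousOn ρ (Ici 0)
  mono : MonotoneOn ρ (Ici 0)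
  subadd : ∀ s t, 0 ≤ s → 0 ≤ t → ρ (s + t) ≤ ρ s + ρ t
  zero : ρ 0 = 0
  concave : ConcaveOn ℝ (Ici 0) ρ

/-- `U` is twice differentiable at `m`: on the neighbourhood `V` of `m` it is differentiable with
gradients (given by the versions `g ν`, for `ν ∈ V`) that are continuous and of linear growth, and
the gradient has at `m` a first order expansion with the bounded Borel coefficients `At`, `A`. -/
structure HasExpansion {d : ℕ} (U : P2 d → ℝ) (V : Set (P2 d)) (g : P2 d → E d → E d)
    (m : P2 d) (At : E d → E d →L[ℝ] E d) (A : E d → E d → E d →L[ℝ] E d) : Prop where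
  nhds : V ∈ 𝓝 m
  grad : ∀ ν ∈ V, HasGradAt U ν (g ν)
  cont : ∀ ν ∈ V, Continuous (g ν)
  growth : ∃ C : ℝ, ∀ ν ∈ V, ∀ x, ‖g ν x‖ ≤ C * (1 + ‖x‖)
  measAt : Measurable At
  bddAt : ∃ K : ℝ, ∀ x, ‖At x‖ ≤ K
  measA : Measurable (fun p : E d × E d => A p.1 p.2)
  bddA : ∃ K : ℝ, ∀ x a, ‖A x a‖ ≤ K
  expansion : ∃ ρ ε₂ : ℝ → ℝ, IsConcaveModulus ρ ∧ (∀ t, 0 ≤ t → 0 ≤ ε₂ t) ∧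
    Tendsto ε₂ (𝓝[>] 0) (𝓝 0) ∧
    ∀ ν ∈ V, ∀ γ ∈ optCouplings m ν, ∀ x y,
      ‖g ν y - g m x - linPart At A γ x y‖
        ≤ ‖x - y‖ * ρ ‖x - y‖ + W2 m ν * ε₂ (W2 m ν)

/-- `U` is twice differentiable at `m` (with gradients given by the versions `g ν` near `m`) and
`B` is a version of its second order Wasserstein gradient `∇²_w U[m] = π_m(A)`. -/
def HasSecondGradAt {d : ℕ} (U : P2 d → ℝ) (g : P2 d → E d → E d) (m : P2 d)
    (B : E d → E d → E d →L[ℝ] E d) : Prop :=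
  ∃ V At A, HasExpansion U V g m At A ∧ IsTangentProj m A B

/-- `U` is twice continuously differentiable on `O`, with `g` the gradient, `At` the coefficient
`Ã` and `B` the second order Wasserstein gradient `π_ν(A_{νν})`. -/
structure TwiceContDiffOn {d : ℕ} (U : P2 d → ℝ) (O : Set (P2 d)) (g : P2 d → E d → E d)
    (At : P2 d → E d → E d →L[ℝ] E d) (B : P2 d → E d → E d → E d →L[ℝ] E d) : Prop where
  twice : ∀ m ∈ O, ∃ V A, HasExpansion U V g m (At m) A ∧ IsTangentProj m A (B m)
  contAt : ContinuousOn (fun p : E d × P2 d => At p.2 p.1) (univ ×ˢ O)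
  contB : ContinuousOn (fun p : (E d × E d) × P2 d => B p.2 p.1.1 p.1.2) (univ ×ˢ O)

end Wass

end

noncomputable section

namespace Wass

open scoped NNReal

variable {d : ℕ}

/-! The constants in both Taylor bounds do not depend on `N`, so the bounds survive the limit: `G`
is approximated by the pairing with `A m` up to a quadratic error, and `A` has the required
expansion with coefficients `At m` and `A2 m`. The real content is that `A m` has minimal norm among
the subgradients, and for this it is enough that it lies in the tangent space.

Minimality (`eLpNorm_le_of_mem_subgradients`): for a test function `φ` and small `t > 0`, the only
optimal plan from `m` to `(id + t∇φ)_# m` is the graph of `id + t∇φ` (`ae_eq_add_gradient`). Testing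
any subgradient `ξ` along these curves, with both signs of `φ`, gives `ξ - A m ⊥ ∇φ`. If `A m` is
tangent, Pythagoras concludes.

Tangency: a continuous gradient of linear growth is tangent, by cutoff and mollification
(`toLp_mem_tangentSpace_of_hasGradientAt`), so by the Poincaré lemma it suffices that the spatial
derivative is symmetric. This is proved for each `G_N` in `symmetric_of_taylor` and passed to the
limit. At a measure `a m' + b δ_x`, with `m'` vanishing near `x`, moving the atom is optimal, so `z
↦ G_N(a m' + b δ_z)` is an ordinary function with gradient `b ∇_w G_N(z)` and second derivative `b
(D + b B)` at `x`. Hence `D + b B` is symmetric (`symmetric_of_atom`). Such measures approximate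
every `m` with `b → 0` (`exists_seq_addAtom`), which leaves `D`.

The rows of the second order gradients are tangent for each `N`, and closedness of the tangent space
carries this over to `A2` (`isTangentProj_of_tendstoUniformly`). -/

/-! ### Couplings, quadratic cost and the value of `W2` -/

lemma isProbabilityMeasure_of_mem_couplings {m ν : P2 d} {γ : Measure (E d × E d)}
    (h : γ ∈ couplings m ν) : IsProbabilityMeasure γ := by
  constructor
  rw [← Measure.fst_univ, h.1]
  exact measure_univ

lemma measurePreserving_fst_of_mem_couplings {m ν : P2 d} {γ : Measure (E d × E d)}
    (h : γ ∈ couplings m ν) : MeasurePreserving Prod.fst γ m.meas :=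
  ⟨measurable_fst, h.1⟩

lemma measurePreserving_snd_of_mem_couplings {m ν : P2 d} {γ : Measure (E d × E d)}
    (h : γ ∈ couplings m ν) : MeasurePreserving Prod.snd γ ν.meas :=
  ⟨measurable_snd, h.2⟩

/-- The cost of a plan as an `L²` norm. -/
lemma eLpNorm_sub_sq_eq_cost (γ : Measure (E d × E d)) :
    eLpNorm (fun p : E d × E d => p.1 - p.2) 2 γ ^ 2 = cost γ := by
  have := eLpNorm_nnreal_pow_eq_lintegral (μ := γ) (f := fun p : E d × E d => p.1 - p.2)
    (p := 2) (by norm_num)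
  simpa [cost] using this

lemma memLp_id (m : P2 d) : MemLp (fun x : E d => x) 2 m.meas := by
  refine ⟨by fun_prop, ?_⟩
  have := eLpNorm_nnreal_pow_eq_lintegral (μ := m.meas) (f := fun x : E d => x)
    (p := 2) (by norm_num)
  have h2 : eLpNorm (fun x : E d => x) 2 m.meas ^ 2 < ⊤ := by
    have h3 := m.secondMoment
    simp at this
    rwa [this]
  exact (ENNReal.pow_lt_top_iff.1 h2).resolve_right (by norm_num)

lemma secondMoment_of_memLp {μ : Measure (E d)} (h : MemLp (fun x : E d => x) 2 μ) :
    ∫⁻ x, ‖x‖ₑ ^ 2 ∂μ < ⊤ := by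
  have := eLpNorm_nnreal_pow_eq_lintegral (μ := μ) (f := fun x : E d => x)
    (p := 2) (by norm_num)
  simp at this
  rw [← this]
  exact ENNReal.pow_lt_top h.2

lemma memLp_fst_of_mem_couplings {m ν : P2 d} {γ : Measure (E d × E d)}
    (h : γ ∈ couplings m ν) : MemLp (fun p : E d × E d => p.1) 2 γ :=
  (memLp_id m).comp_measurePreserving (measurePreserving_fst_of_mem_couplings h)

lemma memLp_snd_of_mem_couplings {m ν : P2 d} {γ : Measure (E d × E d)}
    (h : γ ∈ couplings m ν) : MemLp (fun p : E d × E d => p.2) 2 γ :=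
  (memLp_id ν).comp_measurePreserving (measurePreserving_snd_of_mem_couplings h)

lemma cost_lt_top {m ν : P2 d} {γ : Measure (E d × E d)}
    (h : γ ∈ couplings m ν) : cost γ < ⊤ := by
  rw [← eLpNorm_sub_sq_eq_cost]
  exact ENNReal.pow_lt_top ((memLp_fst_of_mem_couplings h).sub (memLp_snd_of_mem_couplings h)).2

lemma prod_mem_couplings (m ν : P2 d) : m.meas.prod ν.meas ∈ couplings m ν :=
  ⟨by simp, by simp⟩

lemma W2_nonneg (m ν : P2 d) : 0 ≤ W2 m ν := Real.sqrt_nonneg _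

lemma ofReal_W2_sq (m ν : P2 d) :
    ENNReal.ofReal (W2 m ν ^ 2) = ⨅ γ ∈ couplings m ν, cost γ := by
  rw [W2, Real.sq_sqrt ENNReal.toReal_nonneg, ENNReal.ofReal_toReal]
  exact ((iInf₂_le _ (prod_mem_couplings m ν)).trans_lt (cost_lt_top (prod_mem_couplings m ν))).ne

lemma ofReal_W2_sq_le_cost {m ν : P2 d} {γ : Measure (E d × E d)} (h : γ ∈ couplings m ν) :
    ENNReal.ofReal (W2 m ν ^ 2) ≤ cost γ := by
  rw [ofReal_W2_sq]
  exact iInf₂_le _ h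

/-- A plan that costs at most as much as any other one is optimal. -/
lemma mem_optCouplings_of_forall_le {m ν : P2 d} {γ : Measure (E d × E d)}
    (h : γ ∈ couplings m ν) (hle : ∀ γ' ∈ couplings m ν, cost γ ≤ cost γ') :
    γ ∈ optCouplings m ν := by
  refine ⟨h, le_antisymm ?_ (ofReal_W2_sq_le_cost h)⟩
  rw [ofReal_W2_sq]
  exact le_iInf₂ hle

lemma ofReal_W2_le_eLpNorm {m ν : P2 d} {γ : Measure (E d × E d)} (h : γ ∈ couplings m ν) :
    ENNReal.ofReal (W2 m ν) ≤ eLpNorm (fun p : E d × E d => p.1 - p.2) 2 γ := by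
  have := ofReal_W2_sq_le_cost h
  rw [← eLpNorm_sub_sq_eq_cost, ENNReal.ofReal_pow (W2_nonneg m ν)] at this
  exact (ENNReal.pow_le_pow_left_iff (by norm_num)).1 this

lemma ofReal_W2_eq_eLpNorm {m ν : P2 d} {γ : Measure (E d × E d)} (h : γ ∈ optCouplings m ν) :
    ENNReal.ofReal (W2 m ν) = eLpNorm (fun p : E d × E d => p.1 - p.2) 2 γ := by
  have := h.2
  rw [← eLpNorm_sub_sq_eq_cost, ENNReal.ofReal_pow (W2_nonneg m ν)] at this
  exact le_antisymm (ofReal_W2_le_eLpNorm h.1)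
    ((ENNReal.pow_le_pow_left_iff (by norm_num)).1 this.le)

/-! ### Existence of optimal plans -/

/-- Prokhorov: the two marginals are fixed, hence tight, and fixing them is a closed condition
because push-forward is weakly continuous. -/
lemma isCompact_couplings (m ν : P2 d) :
    IsCompact {γ : ProbabilityMeasure (E d × E d) | (γ : Measure (E d × E d)) ∈ couplings m ν} := by
  set S := {γ : ProbabilityMeasure (E d × E d) | (γ : Measure (E d × E d)) ∈ couplings m ν}
  have hclosed : IsClosed S := by
    let pm (m : P2 d) : ProbabilityMeasure (E d) := ⟨m.meas, m.isProb⟩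
    have h1 : S = (fun γ : ProbabilityMeasure (E d × E d) =>
          (γ.map continuous_fst.aemeasurable, γ.map continuous_snd.aemeasurable)) ⁻¹'
        {(pm m, pm ν)} := by
      ext γ
      rw [mem_preimage, mem_singleton_iff, Prod.mk.injEq]
      exact and_congr ⟨fun h => Subtype.ext h, fun h => congrArg Subtype.val h⟩
        ⟨fun h => Subtype.ext h, fun h => congrArg Subtype.val h⟩
    rw [h1]
    exact isClosed_singleton.preimage
      ((ProbabilityMeasure.continuous_map continuous_fst).prodMk
        (ProbabilityMeasure.continuous_map continuous_snd))
  have htight : IsTightMeasureSet {((γ : ProbabilityMeasure (E d × E d)) :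
      Measure (E d × E d)) | γ ∈ S} := by
    refine IsTightMeasureSet.prodMk
      ((isTightMeasureSet_singleton (μ := m.meas)).subset ?_)
      ((isTightMeasureSet_singleton (μ := ν.meas)).subset ?_)
    · rintro _ ⟨_, ⟨γ, hγ, rfl⟩, rfl⟩
      exact hγ.1
    · rintro _ ⟨_, ⟨γ, hγ, rfl⟩, rfl⟩
      exact hγ.2
  simpa [hclosed.closure_eq] using isCompact_closure_of_isTightMeasureSet htight

/-- By monotone convergence the cost is the supremum over `n` of the integrals of `min(|x - y|²,
n)`, each of which is weakly continuous. -/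
lemma lowerSemicontinuous_cost :
    LowerSemicontinuous
      (fun γ : ProbabilityMeasure (E d × E d) => cost (γ : Measure (E d × E d))) := by
  let f : ℕ → BoundedContinuousFunction (E d × E d) NNReal := fun n =>
    BoundedContinuousFunction.mkOfBound ⟨fun p => min (‖p.1 - p.2‖₊ ^ 2) n, by fun_prop⟩ n (by
      intro x y
      rw [NNReal.dist_eq, abs_le]
      have h1 : ((min (‖x.1 - x.2‖₊ ^ 2) n : NNReal) : ℝ) ≤ n := by
        exact_mod_cast min_le_right _ _
      have h2 : ((min (‖y.1 - y.2‖₊ ^ 2) n : NNReal) : ℝ) ≤ n := by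
        exact_mod_cast min_le_right _ _
      constructor
      · simp only [ContinuousMap.coe_mk]
        linarith [(min (‖x.1 - x.2‖₊ ^ 2) (n : NNReal)).coe_nonneg]
      · simp only [ContinuousMap.coe_mk]
        linarith [(min (‖y.1 - y.2‖₊ ^ 2) (n : NNReal)).coe_nonneg])
  have hf : ∀ n p, f n p = min (‖p.1 - p.2‖₊ ^ 2) (n : NNReal) := fun _ _ => rfl
  have key : (fun γ : ProbabilityMeasure (E d × E d) => cost (γ : Measure (E d × E d))) =
      fun γ : ProbabilityMeasure (E d × E d) => ⨆ n, ∫⁻ p, f n p ∂(γ : Measure (E d × E d)) := by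
    funext γ
    rw [← lintegral_iSup]
    · unfold cost
      refine lintegral_congr fun p => ?_
      obtain ⟨k, hk⟩ := exists_nat_ge (‖p.1 - p.2‖₊ ^ 2)
      apply le_antisymm
      · refine le_iSup_of_le k ?_
        rw [hf, min_eq_left hk]
        simp [enorm]
      · refine iSup_le fun n =>
          (ENNReal.coe_le_coe.2 ((hf n p).trans_le (min_le_left _ _))).trans_eq ?_
        simp [enorm]
    · intro n
      exact (f n).measurable_coe_ennreal_comp
    · intro a b hab p
      simp only [hf]
      exact_mod_cast min_le_min_left _ (by exact_mod_cast hab)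
  rw [key]
  exact lowerSemicontinuous_iSup fun n =>
    (ProbabilityMeasure.continuous_lintegral_boundedContinuousFunction (f n)).lowerSemicontinuous

/-- Optimal transport plans exist. -/
lemma optCouplings_nonempty (m ν : P2 d) : (optCouplings m ν).Nonempty := by
  obtain ⟨γ, hγ, hmin⟩ := LowerSemicontinuousOn.exists_isMinOn
    (s := {γ : ProbabilityMeasure (E d × E d) | (γ : Measure (E d × E d)) ∈ couplings m ν})
    ⟨⟨_, isProbabilityMeasure_of_mem_couplings (prod_mem_couplings m ν)⟩, prod_mem_couplings m ν⟩
    (isCompact_couplings m ν) (lowerSemicontinuous_cost.lowerSemicontinuousOn _)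
  refine ⟨γ, mem_optCouplings_of_forall_le hγ fun γ' hγ' => ?_⟩
  exact isMinOn_iff.1 hmin ⟨γ', isProbabilityMeasure_of_mem_couplings hγ'⟩ hγ'

/-! ### Gluing, the triangle inequality and the topology of `W2` -/

/-- Two plans with a common marginal can be glued. -/
lemma exists_gluing {m₁ m₂ m₃ : P2 d} {γ₁ γ₂ : Measure (E d × E d)} (h₁ : γ₁ ∈ couplings m₁ m₂)
    (h₂ : γ₂ ∈ couplings m₂ m₃) : ∃ Γ : Measure ((E d × E d) × E d),
      Γ.fst = γ₁ ∧ Γ.map (fun p => (p.1.2, p.2)) = γ₂ := by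
  have := isProbabilityMeasure_of_mem_couplings h₁
  have := isProbabilityMeasure_of_mem_couplings h₂
  -- Draw `(x, y)` from `γ₁`, then the third point from the conditional law of `γ₂` given `y`; the
  -- common middle marginal makes the last two coordinates distributed as `γ₂`.
  refine ⟨γ₁.compProd (γ₂.condKernel.comap Prod.snd measurable_snd), by simp, ?_⟩
  refine Measure.ext_of_lintegral _ fun f hf => ?_
  rw [lintegral_map hf (by fun_prop), Measure.lintegral_compProd (by fun_prop)]
  have h3 : γ₁.snd = γ₂.fst := h₁.2.trans h₂.1.symm
  conv_rhs => rw [← γ₂.disintegrate γ₂.condKernel, Measure.lintegral_compProd hf, ← h3,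
    Measure.snd, lintegral_map (by fun_prop) measurable_snd]
  simp

lemma W2_triangle (m₁ m₂ m₃ : P2 d) : W2 m₁ m₃ ≤ W2 m₁ m₂ + W2 m₂ m₃ := by
  obtain ⟨γ₁, h₁⟩ := optCouplings_nonempty m₁ m₂
  obtain ⟨γ₂, h₂⟩ := optCouplings_nonempty m₂ m₃
  obtain ⟨Γ, hΓ₁, hΓ₂⟩ := exists_gluing h₁.1 h₂.1
  have hc : Γ.map (fun p => (p.1.1, p.2)) ∈ couplings m₁ m₃ := by
    constructor
    · rw [← h₁.1.1, ← hΓ₁, Measure.fst, Measure.fst, Measure.fst,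
        Measure.map_map (by fun_prop) (by fun_prop), Measure.map_map (by fun_prop) (by fun_prop)]
      rfl
    · rw [← h₂.1.2, ← hΓ₂, Measure.snd, Measure.snd,
        Measure.map_map (by fun_prop) (by fun_prop), Measure.map_map (by fun_prop) (by fun_prop)]
      rfl
  have h := ofReal_W2_le_eLpNorm hc
  rw [eLpNorm_map_measure (by fun_prop) (by fun_prop)] at h
  have h₁' := ofReal_W2_eq_eLpNorm h₁
  have h₂' := ofReal_W2_eq_eLpNorm h₂
  rw [← hΓ₁, Measure.fst, eLpNorm_map_measure (by fun_prop) (by fun_prop)] at h₁'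
  rw [← hΓ₂, eLpNorm_map_measure (by fun_prop) (by fun_prop)] at h₂'
  rw [← ENNReal.ofReal_le_ofReal_iff (add_nonneg (W2_nonneg _ _) (W2_nonneg _ _)),
    ENNReal.ofReal_add (W2_nonneg _ _) (W2_nonneg _ _), h₁', h₂']
  refine h.trans ((eLpNorm_add_le (by fun_prop) (by fun_prop) (by norm_num)).trans_eq' ?_)
  congr 1
  funext p
  simp

lemma map_diag_mem_couplings (m : P2 d) : m.meas.map (fun x => (x, x)) ∈ couplings m m := by
  constructor
  · rw [Measure.fst, Measure.map_map (by fun_prop) (by fun_prop)]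
    exact Measure.map_id
  · rw [Measure.snd, Measure.map_map (by fun_prop) (by fun_prop)]
    exact Measure.map_id

@[simp] lemma W2_self (m : P2 d) : W2 m m = 0 := by
  have h := ofReal_W2_sq_le_cost (map_diag_mem_couplings m)
  rw [cost, lintegral_map (by fun_prop) (by fun_prop)] at h
  simp only [sub_self, enorm_zero, ne_eq, OfNat.ofNat_ne_zero, not_false_eq_true, zero_pow,
    lintegral_zero, nonpos_iff_eq_zero, ENNReal.ofReal_eq_zero] at h
  nlinarith [W2_nonneg m m]

lemma isOpen_ball (m : P2 d) (r : ℝ) : IsOpen (ball m r) :=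
  TopologicalSpace.isOpen_generateFrom_of_mem ⟨m, r, rfl⟩

/-- The generating balls may have any centre; the triangle inequality reduces them to balls centred
at `m`. With `m` kept in the first slot, symmetry of `W2` is not needed. -/
lemma tendsto_nhds_iff_W2 {α : Type*} {l : Filter α} {u : α → P2 d} {m : P2 d} :
    Tendsto u l (𝓝 m) ↔ Tendsto (fun a => W2 m (u a)) l (𝓝 0) := by
  rw [TopologicalSpace.tendsto_nhds_generateFrom_iff]
  constructor
  · intro h
    rw [tendsto_order]
    refine ⟨fun a ha => Eventually.of_forall fun _ => ha.trans_le (W2_nonneg _ _), fun r hr => ?_⟩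
    exact h _ ⟨m, r, rfl⟩ (by simpa [ball] using hr)
  · rintro h _ ⟨c, r, rfl⟩ hm
    have h2 : W2 c m < r := hm
    filter_upwards [(tendsto_order.1 h).2 (r - W2 c m) (by linarith)] with a ha
    exact (W2_triangle c m (u a)).trans_lt (by linarith)

lemma tendsto_W2_nhds (m : P2 d) : Tendsto (fun ν => W2 m ν) (𝓝 m) (𝓝 0) :=
  tendsto_nhds_iff_W2.1 tendsto_id

lemma integrable_norm_sub_sq {m ν : P2 d} {γ : Measure (E d × E d)} (h : γ ∈ couplings m ν) :
    Integrable (fun p => ‖p.1 - p.2‖ ^ 2) γ :=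
  ((memLp_fst_of_mem_couplings h).sub (memLp_snd_of_mem_couplings h)).integrable_norm_pow
    (by norm_num)

lemma cost_eq_ofReal_integral {m ν : P2 d} {γ : Measure (E d × E d)} (h : γ ∈ couplings m ν) :
    cost γ = ENNReal.ofReal (∫ p, ‖p.1 - p.2‖ ^ 2 ∂γ) := by
  rw [ofReal_integral_eq_lintegral_ofReal (integrable_norm_sub_sq h)
    (Eventually.of_forall fun _ => by positivity), cost]
  refine lintegral_congr fun p => ?_
  rw [ENNReal.ofReal_pow (norm_nonneg _), ofReal_norm]

lemma W2_sq_le_integral {m ν : P2 d} {γ : Measure (E d × E d)} (h : γ ∈ couplings m ν) :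
    W2 m ν ^ 2 ≤ ∫ p, ‖p.1 - p.2‖ ^ 2 ∂γ := by
  have := ofReal_W2_sq_le_cost h
  rwa [cost_eq_ofReal_integral h, ENNReal.ofReal_le_ofReal_iff (by positivity)] at this

lemma W2_sq_eq_integral {m ν : P2 d} {γ : Measure (E d × E d)} (h : γ ∈ optCouplings m ν) :
    W2 m ν ^ 2 = ∫ p, ‖p.1 - p.2‖ ^ 2 ∂γ := by
  have := h.2
  rwa [cost_eq_ofReal_integral h.1, eq_comm, ENNReal.ofReal_eq_ofReal_iff (by positivity)
    (by positivity)] at this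

/-! ### Transport maps that induce the only optimal plan -/

/-- The image measure `T_# m`. -/
def P2.map (m : P2 d) (T : E d → E d) (hT : MemLp T 2 m.meas) : P2 d where
  meas := m.meas.map T
  isProb := Measure.isProbabilityMeasure_map hT.1.aemeasurable
  secondMoment := secondMoment_of_memLp <|
    (memLp_map_measure_iff (by fun_prop) hT.1.aemeasurable).2 hT

lemma map_graph_mem_couplings {m : P2 d} {T : E d → E d} (hT : MemLp T 2 m.meas)
    (hTm : Measurable T) : m.meas.map (fun x => (x, T x)) ∈ couplings m (m.map T hT) := by
  constructor
  · rw [Measure.fst, Measure.map_map (by fun_prop) (by fun_prop)]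
    exact Measure.map_id
  · rw [Measure.snd, Measure.map_map (by fun_prop) (by fun_prop)]
    rfl

lemma W2_sq_map_le {m : P2 d} {T : E d → E d} (hT : MemLp T 2 m.meas) (hTm : Measurable T) :
    W2 m (m.map T hT) ^ 2 ≤ ∫ x, ‖x - T x‖ ^ 2 ∂m.meas := by
  refine (W2_sq_le_integral (map_graph_mem_couplings hT hTm)).trans_eq ?_
  rw [integral_map (by fun_prop)]
  exact Measurable.aestronglyMeasurable (by fun_prop)

/-- A map `T` with inverse `S` for which a bounded Kantorovich potential has a quadratic gap
induces the only optimal plan between `m` and `T_# m`. -/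
lemma ae_eq_of_mem_optCouplings_map {m : P2 d} {T S : E d → E d} (hT : MemLp T 2 m.meas)
    (hTm : Measurable T) (hSm : Measurable S) (hST : ∀ x, S (T x) = x) (hTS : ∀ y, T (S y) = y)
    {f : E d → ℝ} (hf : Measurable f) {K : ℝ} (hK : ∀ x, ‖f x‖ ≤ K) {c : ℝ} (hc : 0 < c)
    (hgap : ∀ x y, c * ‖x - S y‖ ^ 2 ≤ ‖x - y‖ ^ 2 - ‖S y - y‖ ^ 2 + (f x - f (S y)))
    {γ : Measure (E d × E d)} (hγ : γ ∈ optCouplings m (m.map T hT)) :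
    ∀ᵐ p ∂γ, p.2 = T p.1 := by
  have hp := isProbabilityMeasure_of_mem_couplings hγ.1
  have hfst := measurePreserving_fst_of_mem_couplings hγ.1
  have hsnd := measurePreserving_snd_of_mem_couplings hγ.1
  have hTmp : MeasurePreserving T m.meas (m.map T hT).meas := ⟨hTm, rfl⟩
  have hS2 : MemLp (fun y => S y) 2 (m.map T hT).meas := by
    refine (memLp_map_measure_iff hSm.aestronglyMeasurable hTm.aemeasurable).2 ?_
    exact (memLp_id m).congr_norm (hSm.comp hTm).aestronglyMeasurable (by simp [hST])
  have hS2' : MemLp (fun p : E d × E d => S p.2) 2 γ := hS2.comp_measurePreserving hsnd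
  have i1 := integrable_norm_sub_sq hγ.1
  have i2 : Integrable (fun p : E d × E d => ‖S p.2 - p.2‖ ^ 2) γ :=
    (hS2'.sub (memLp_snd_of_mem_couplings hγ.1)).integrable_norm_pow (by norm_num)
  have i3 : Integrable (fun p : E d × E d => f p.1) γ :=
    Integrable.of_bound (Measurable.aestronglyMeasurable (by fun_prop)) K
      (Eventually.of_forall fun p => hK _)
  have i4 : Integrable (fun p : E d × E d => f (S p.2)) γ :=
    Integrable.of_bound (Measurable.aestronglyMeasurable (by fun_prop)) K
      (Eventually.of_forall fun p => hK _)
  have i5 : Integrable (fun p : E d × E d => c * ‖p.1 - S p.2‖ ^ 2) γ :=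
    (((memLp_fst_of_mem_couplings hγ.1).sub hS2').integrable_norm_pow (by norm_num)).const_mul c
  have i12 : Integrable (fun p : E d × E d => ‖p.1 - p.2‖ ^ 2 - ‖S p.2 - p.2‖ ^ 2) γ := i1.sub i2
  have i34 : Integrable (fun p : E d × E d => f p.1 - f (S p.2)) γ := i3.sub i4
  have e2 : ∫ p, ‖S p.2 - p.2‖ ^ 2 ∂γ = ∫ x, ‖x - T x‖ ^ 2 ∂m.meas := by
    rw [← integral_map (φ := Prod.snd) (f := fun y => ‖S y - y‖ ^ 2) (by fun_prop)
      (Measurable.aestronglyMeasurable (by fun_prop)), hsnd.map_eq, ← hTmp.map_eq,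
      integral_map (by fun_prop) (Measurable.aestronglyMeasurable (by fun_prop))]
    simp [hST]
  have e3 : ∫ p, f p.1 ∂γ = ∫ x, f x ∂m.meas := by
    rw [← integral_map (φ := Prod.fst) (f := f) (by fun_prop) (by fun_prop), hfst.map_eq]
  have e4 : ∫ p, f (S p.2) ∂γ = ∫ x, f x ∂m.meas := by
    rw [← integral_map (φ := Prod.snd) (f := fun y => f (S y)) (by fun_prop)
        (Measurable.aestronglyMeasurable (by fun_prop)),
      hsnd.map_eq, ← hTmp.map_eq, integral_map (by fun_prop)
        (Measurable.aestronglyMeasurable (by fun_prop))]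
    simp [hST]
  -- Integrate the gap inequality. The potential terms cancel since `S` pushes the second marginal
  -- back to `m`, and `‖S y - y‖²` integrates to the cost of the graph of `T`, which the optimal
  -- plan cannot exceed.
  have hle : ∫ p, c * ‖p.1 - S p.2‖ ^ 2 ∂γ ≤ 0 := by
    calc ∫ p, c * ‖p.1 - S p.2‖ ^ 2 ∂γ
        ≤ ∫ p, (‖p.1 - p.2‖ ^ 2 - ‖S p.2 - p.2‖ ^ 2 + (f p.1 - f (S p.2))) ∂γ :=
          integral_mono i5 (i12.add i34) fun p => hgap _ _
      _ = W2 m (m.map T hT) ^ 2 - ∫ x, ‖x - T x‖ ^ 2 ∂m.meas := by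
          rw [integral_add i12 i34, integral_sub i1 i2, integral_sub i3 i4,
            e2, e3, e4, W2_sq_eq_integral hγ]
          ring
      _ ≤ 0 := by linarith [W2_sq_map_le hT hTm]
  have h0 : ∫ p, c * ‖p.1 - S p.2‖ ^ 2 ∂γ = 0 :=
    le_antisymm hle (integral_nonneg fun p => by positivity)
  rw [integral_eq_zero_iff_of_nonneg (fun p => by positivity) i5] at h0
  filter_upwards [h0] with p hp
  have : p.1 = S p.2 := by
    have h1 : c * ‖p.1 - S p.2‖ ^ 2 = 0 := hp
    simpa [hc.ne', sub_eq_zero] using h1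
  rw [this, hTS]

lemma abs_sub_inner_gradient_le {φ : E d → ℝ} (hφ : Differentiable ℝ φ) {L : NNReal}
    (hL : LipschitzWith L (gradient φ)) (x z : E d) :
    |φ x - φ z - inner ℝ (gradient φ z) (x - z)| ≤ L * ‖x - z‖ ^ 2 := by
  have h := (convex_segment z x).norm_image_sub_le_of_norm_hasFDerivWithin_le' (f := φ)
    (f' := fun y => InnerProductSpace.toDual ℝ (E d) (gradient φ y))
    (φ := InnerProductSpace.toDual ℝ (E d) (gradient φ z)) (C := L * ‖x - z‖) (x := z) (y := x)
    (fun y _ => ((hφ y).hasGradientAt.hasFDerivAt).hasFDerivWithinAt) (fun y hy => by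
      rw [← map_sub, LinearIsometryEquiv.norm_map]
      refine (hL.norm_sub_le y z).trans ?_
      gcongr
      simpa [norm_sub_rev] using norm_sub_le_of_mem_segment hy)
    (left_mem_segment ℝ z x) (right_mem_segment ℝ z x)
  rw [InnerProductSpace.toDual_apply_apply, Real.norm_eq_abs] at h
  linarith [h]

/-- A small Lipschitz perturbation of the identity has a continuous inverse. -/
lemma exists_inverse_id_add {u : E d → E d} {K : NNReal} (hu : LipschitzWith K u) (hK : K < 1) :
    ∃ S : E d → E d, Continuous S ∧ (∀ x, S (x + u x) = x) ∧ ∀ y, S y + u (S y) = y := by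
  have happ : ApproximatesLinearOn (fun x => x + u x)
      ((ContinuousLinearEquiv.refl ℝ (E d) : E d ≃L[ℝ] E d) : E d →L[ℝ] E d) univ K := by
    intro x _ y _
    simpa [add_sub_add_comm] using hu.norm_sub_le x y
  -- In dimension 0 the identity has norm 0, so this case is separate.
  have hc : Subsingleton (E d) ∨ K <
      ‖((ContinuousLinearEquiv.refl ℝ (E d)).symm : E d →L[ℝ] E d)‖₊⁻¹ := by
    rcases subsingleton_or_nontrivial (E d) with h | h
    · exact Or.inl h
    · right
      have : ‖((ContinuousLinearEquiv.refl ℝ (E d)).symm : E d →L[ℝ] E d)‖₊ = 1 := by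
        ext
        exact ContinuousLinearMap.norm_id
      rw [this]
      simpa using hK
  let H := happ.toHomeomorph (fun x => x + u x) hc
  exact ⟨H.symm, H.symm.continuous, H.symm_apply_apply, H.apply_symm_apply⟩

/-- For a test function `φ` with small gradient, the only optimal plan from `m` to
`(id + ∇φ)_# m` is induced by `id + ∇φ`. -/
lemma ae_eq_add_gradient {m : P2 d} {φ : E d → ℝ} (hφ : Differentiable ℝ φ)
    {L : NNReal} (hL : LipschitzWith L (gradient φ)) (hL4 : (L : ℝ) ≤ 1 / 4) {K : ℝ}
    (hK : ∀ x, ‖φ x‖ ≤ K) (hT : MemLp (fun x => x + gradient φ x) 2 m.meas)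
    {γ : Measure (E d × E d)} (hγ : γ ∈ optCouplings m (m.map _ hT)) :
    ∀ᵐ p ∂γ, p.2 = p.1 + gradient φ p.1 := by
  have hL1 : L < 1 := by
    rw [← NNReal.coe_lt_coe]
    exact hL4.trans_lt (by norm_num)
  obtain ⟨S, hS, hST, hTS⟩ := exists_inverse_id_add hL hL1
  have hcont := hL.continuous
  -- With `z = S y` and potential `2φ`, the right side of the gap is `‖x - z‖² + 2(φ x - φ z - ⟨∇φ
  -- z, x - z⟩)`, at least `(1 - 2L)‖x - z‖²`; hence `c = 1/2` when `L ≤ 1/4`.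
  refine ae_eq_of_mem_optCouplings_map (T := fun x => x + gradient φ x) (S := S) hT
    (by fun_prop) hS.measurable hST hTS (f := fun x => 2 * φ x)
    (hφ.continuous.measurable.const_mul 2) (K := 2 * K) (fun x => ?_) (c := 1 / 2) (by norm_num)
    (fun x y => ?_) hγ
  · rw [norm_mul, Real.norm_two]
    linarith [hK x]
  · set z := S y with hz
    have hy : y = z + gradient φ z := (hTS y).symm
    have h1 := abs_le.1 (abs_sub_inner_gradient_le hφ hL x z)
    have h2 : ‖x - y‖ ^ 2 = ‖x - z‖ ^ 2 - 2 * inner ℝ (gradient φ z) (x - z)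
        + ‖gradient φ z‖ ^ 2 := by
      rw [hy, ← sub_sub, norm_sub_sq_real, real_inner_comm]
    have h3 : ‖z - y‖ ^ 2 = ‖gradient φ z‖ ^ 2 := by
      rw [hy, sub_add_cancel_left, norm_neg]
    rw [h2, h3]
    have h4 : (L : ℝ) * ‖x - z‖ ^ 2 ≤ 1 / 4 * ‖x - z‖ ^ 2 := by gcongr
    linarith [h1.1]

/-! ### First variation along gradients of test functions -/

lemma gradient_const_mul {φ : E d → ℝ} (hφ : Differentiable ℝ φ) (t : ℝ) :
    gradient (fun x => t * φ x) = fun x => t • gradient φ x := by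
  funext x
  refine HasGradientAt.gradient ?_
  rw [hasGradientAt_iff_hasFDerivAt, map_smul]
  exact (hφ x).hasGradientAt.hasFDerivAt.const_mul t

lemma contDiff_gradient {φ : E d → ℝ} (hφ : ContDiff ℝ ∞ φ) : ContDiff ℝ ∞ (gradient φ) :=
  (InnerProductSpace.toDual ℝ (E d)).symm.contDiff.comp (hφ.fderiv_right (m := ∞) (by simp))

lemma hasCompactSupport_gradient {φ : E d → ℝ} (hφ : HasCompactSupport φ) :
    HasCompactSupport (gradient φ) :=
  (hφ.fderiv ℝ).comp_left (map_zero _)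

lemma memLp_of_continuous_hasCompactSupport {F : Type*} [NormedAddCommGroup F] {f : E d → F}
    (hf : Continuous f) (hs : HasCompactSupport f) (m : P2 d) : MemLp f 2 m.meas :=
  hf.memLp_of_hasCompactSupport hs

lemma pairing_eq_of_ae {m ν : P2 d} {γ : Measure (E d × E d)} (hγ : γ ∈ couplings m ν)
    {w : E d → E d} (hw : Measurable w) {t : ℝ} (hae : ∀ᵐ p ∂γ, p.2 = p.1 + t • w p.1)
    {ξ : E d → E d} (hξ : AEStronglyMeasurable ξ m.meas) :
    pairing ξ γ = t * ∫ x, inner ℝ (ξ x) (w x) ∂m.meas := by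
  have h1 : pairing ξ γ = ∫ p, t * inner ℝ (ξ p.1) (w p.1) ∂γ := by
    refine integral_congr_ae ?_
    filter_upwards [hae] with p hp
    rw [hp, add_sub_cancel_left, inner_smul_right]
  rw [h1, integral_const_mul, ← hγ.1, Measure.fst, integral_map (by fun_prop)]
  rw [← Measure.fst, hγ.1]
  exact hξ.inner hw.aestronglyMeasurable

lemma integrable_inner_of_memLp {μ : Measure (E d)} {f g : E d → E d} (hf : MemLp f 2 μ)
    (hg : MemLp g 2 μ) : Integrable (fun x => inner ℝ (f x) (g x)) μ :=
  ((L2.integrable_inner (𝕜 := ℝ) (hf.toLp f) (hg.toLp g)).congr (by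
    filter_upwards [hf.coeFn_toLp, hg.coeFn_toLp] with x h1 h2 using by rw [h1, h2]))

/-- `ζ` is a Wasserstein gradient of `U` at `m` up to a quadratic error, along all optimal
plans. -/
def HasQuadraticApprox (U : P2 d → ℝ) (m : P2 d) (ζ : E d → E d) : Prop :=
  ∃ C : ℝ, ∀ᶠ ν in 𝓝 m, ∀ γ ∈ optCouplings m ν, |U ν - U m - pairing ζ γ| ≤ C * W2 m ν ^ 2

/-- Along `(id + t∇φ)_# m` the optimal plan is unique, so the infimum in the subgradient inequality
is the single value `t ∫ ξ·∇φ`, while `U` changes by `t ∫ ζ·∇φ + O(t²)`. Compare, divide by `t`, and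
let `t → 0`, then `ε → 0`. -/
lemma integral_inner_sub_gradient_nonpos {U : P2 d → ℝ} {m : P2 d} {ζ ξ : E d → E d}
    (hζ : MemLp ζ 2 m.meas) (hU : HasQuadraticApprox U m ζ) (hξ : ξ ∈ subgradients U m)
    {φ : E d → ℝ} (hφ : ContDiff ℝ ∞ φ) (hs : HasCompactSupport φ) :
    ∫ x, inner ℝ (ξ x - ζ x) (gradient φ x) ∂m.meas ≤ 0 := by
  obtain ⟨C, hC⟩ := hU
  have hφd : Differentiable ℝ φ := hφ.differentiable (by simp)
  have hgc := contDiff_gradient hφ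
  have hgs := hasCompactSupport_gradient hs
  obtain ⟨L, hL⟩ := hgc.lipschitzWith_of_hasCompactSupport hgs (by simp)
  obtain ⟨M, hM⟩ := hgc.continuous.bounded_above_of_compact_support hgs
  obtain ⟨K, hK⟩ := hφ.continuous.bounded_above_of_compact_support hs
  have hM0 : 0 ≤ M := (norm_nonneg _).trans (hM 0)
  have hw : MemLp (gradient φ) 2 m.meas :=
    memLp_of_continuous_hasCompactSupport hgc.continuous hgs m
  have hT : ∀ t : ℝ, MemLp (fun x => x + gradient (fun y => t * φ y) x) 2 m.meas := fun t => by
    rw [gradient_const_mul hφd]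
    exact (memLp_id m).add (hw.const_smul t)
  set D := ∫ x, inner ℝ (ξ x - ζ x) (gradient φ x) ∂m.meas
  have hW : ∀ t : ℝ, 0 ≤ t → W2 m (m.map _ (hT t)) ≤ t * M := fun t ht => by
    refine abs_le_of_sq_le_sq' ?_ (by positivity) |>.2
    refine (W2_sq_map_le (hT t) ?_).trans ?_
    · rw [gradient_const_mul hφd]
      have := hgc.continuous
      fun_prop
    · calc ∫ x, ‖x - (x + gradient (fun y => t * φ y) x)‖ ^ 2 ∂m.meas
          ≤ ∫ _, (t * M) ^ 2 ∂m.meas := by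
            refine integral_mono_of_nonneg (Eventually.of_forall fun x => by positivity)
              (integrable_const _) (Eventually.of_forall fun x => ?_)
            simp only [sub_add_cancel_left, norm_neg, gradient_const_mul hφd, norm_smul,
              Real.norm_eq_abs, abs_of_nonneg ht]
            gcongr
            exact hM x
        _ = (t * M) ^ 2 := by simp
  have hlim : Tendsto (fun t : ℝ => m.map _ (hT t)) (𝓝[>] 0) (𝓝 m) := by
    rw [tendsto_nhds_iff_W2]
    have h1 : Tendsto (fun t : ℝ => t * M) (𝓝[>] 0) (𝓝 0) := by
      have : Tendsto (fun t : ℝ => t * M) (𝓝 0) (𝓝 (0 * M)) := tendsto_id.mul_const M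
      rw [zero_mul] at this
      exact this.mono_left nhdsWithin_le_nhds
    refine squeeze_zero' (Eventually.of_forall fun _ => W2_nonneg _ _) ?_ h1
    filter_upwards [self_mem_nhdsWithin] with t ht using hW t ht.le
  have hsmall : ∀ᶠ t : ℝ in 𝓝[>] 0, t * L ≤ 1 / 4 := by
    have : Tendsto (fun t : ℝ => t * L) (𝓝 0) (𝓝 (0 * L)) := tendsto_id.mul_const _
    rw [zero_mul] at this
    exact ((this.mono_left nhdsWithin_le_nhds).eventually_lt_const (by norm_num)).mono
      fun t ht => ht.le
  -- Since `W2 ≤ t M`, after division by `t` the error `ε W2` contributes `ε M` and the quadratic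
  -- error `|C| t M²`.
  have key : ∀ ε : ℝ, 0 < ε → ∀ᶠ t : ℝ in 𝓝[>] 0, D ≤ ε * M + |C| * (t * M ^ 2) := by
    intro ε hε
    filter_upwards [hlim.eventually hC, hlim.eventually (hξ.2 ε hε), hsmall,
      self_mem_nhdsWithin] with t h1 h2 h3 (h4 : 0 < t)
    set ν := m.map _ (hT t)
    obtain ⟨γ₀, hγ₀⟩ := optCouplings_nonempty m ν
    have hLt : LipschitzWith (Real.toNNReal t * L) (gradient fun y => t * φ y) := by
      rw [gradient_const_mul hφd]
      have := (lipschitzWith_smul t).comp hL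
      rwa [Real.nnnorm_of_nonneg h4.le, ← Real.toNNReal_of_nonneg h4.le] at this
    have hae : ∀ γ ∈ optCouplings m ν, ∀ᵐ p ∂γ, p.2 = p.1 + t • gradient φ p.1 := by
      intro γ hγ
      have := ae_eq_add_gradient (hφd.const_mul t) hLt
        (by simpa [h4.le] using h3) (K := t * K)
        (fun x => by rw [norm_mul, Real.norm_eq_abs, abs_of_pos h4]; gcongr; exact hK x)
        (hT t) hγ
      simpa only [gradient_const_mul hφd] using this
    have hp : ∀ η : E d → E d, MemLp η 2 m.meas → ∀ γ ∈ optCouplings m ν,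
        pairing η γ = t * ∫ x, inner ℝ (η x) (gradient φ x) ∂m.meas := fun η hη γ hγ =>
      pairing_eq_of_ae hγ.1 hgc.continuous.measurable (hae γ hγ) hη.1
    have himg : pairing ξ '' optCouplings m ν =
        {t * ∫ x, inner ℝ (ξ x) (gradient φ x) ∂m.meas} := by
      ext a
      constructor
      · rintro ⟨γ, hγ, rfl⟩
        exact hp ξ hξ.1 γ hγ
      · rintro rfl
        exact ⟨γ₀, hγ₀, hp ξ hξ.1 γ₀ hγ₀⟩
    rw [himg, csInf_singleton] at h2
    have h5 := (abs_le.1 (h1 γ₀ hγ₀)).2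
    rw [hp ζ hζ γ₀ hγ₀] at h5
    have hD : D = ∫ x, inner ℝ (ξ x) (gradient φ x) ∂m.meas -
        ∫ x, inner ℝ (ζ x) (gradient φ x) ∂m.meas := by
      rw [← integral_sub (integrable_inner_of_memLp hξ.1 hw)
        (integrable_inner_of_memLp hζ hw)]
      simp only [D, inner_sub_left]
    have h6 : t * D ≤ t * (ε * M + |C| * (t * M ^ 2)) := by
      have h7 : ε * W2 m ν ≤ ε * (t * M) := by gcongr; exact hW t h4.le
      have h8 : C * W2 m ν ^ 2 ≤ |C| * (t * M) ^ 2 := by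
        gcongr
        · exact le_abs_self C
        · exact W2_nonneg _ _
        · exact hW t h4.le
      rw [hD]
      nlinarith
    exact le_of_mul_le_mul_left h6 h4
  have key2 : ∀ ε : ℝ, 0 < ε → D ≤ ε * M := by
    intro ε hε
    have h1 : Tendsto (fun t : ℝ => ε * M + |C| * (t * M ^ 2)) (𝓝[>] 0) (𝓝 (ε * M)) := by
      have : Tendsto (fun t : ℝ => ε * M + |C| * (t * M ^ 2)) (𝓝 0)
          (𝓝 (ε * M + |C| * (0 * M ^ 2))) := by
        apply Continuous.tendsto
        fun_prop
      simp only [zero_mul, mul_zero, add_zero] at this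
      exact this.mono_left nhdsWithin_le_nhds
    exact ge_of_tendsto h1 (key ε hε)
  have h2 : Tendsto (fun ε : ℝ => ε * M) (𝓝[>] 0) (𝓝 0) := by
    have : Tendsto (fun t : ℝ => t * M) (𝓝 0) (𝓝 (0 * M)) := tendsto_id.mul_const M
    rw [zero_mul] at this
    exact this.mono_left nhdsWithin_le_nhds
  refine ge_of_tendsto h2 ?_
  filter_upwards [self_mem_nhdsWithin] with ε hε using key2 ε hε

lemma integral_inner_sub_gradient_eq_zero {U : P2 d → ℝ} {m : P2 d} {ζ ξ : E d → E d}
    (hζ : MemLp ζ 2 m.meas) (hU : HasQuadraticApprox U m ζ) (hξ : ξ ∈ subgradients U m)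
    {φ : E d → ℝ} (hφ : ContDiff ℝ ∞ φ) (hs : HasCompactSupport φ) :
    ∫ x, inner ℝ (ξ x - ζ x) (gradient φ x) ∂m.meas = 0 := by
  refine le_antisymm (integral_inner_sub_gradient_nonpos hζ hU hξ hφ hs) ?_
  have h := integral_inner_sub_gradient_nonpos hζ hU hξ (φ := fun x => (-1) * φ x)
    (contDiff_const.mul hφ) hs.mul_left
  rw [gradient_const_mul (hφ.differentiable (by simp))] at h
  simp only [neg_smul, one_smul, inner_neg_right, integral_neg] at h
  linarith

/-- If `U` has a gradient in the tangent space with a quadratic error, then this gradient is the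
subgradient of minimal norm. -/
lemma eLpNorm_le_of_mem_subgradients {U : P2 d → ℝ} {m : P2 d} {ζ ξ : E d → E d}
    (hζ : MemLp ζ 2 m.meas) (hU : HasQuadraticApprox U m ζ)
    (hT : hζ.toLp ζ ∈ tangentSpace m) (hξ : ξ ∈ subgradients U m) :
    eLpNorm ζ 2 m.meas ≤ eLpNorm ξ 2 m.meas := by
  -- The generators are orthogonal to `ξ - ζ`, and an orthogonal complement is a closed subspace.
  have hle : tangentSpace m ≤ (ℝ ∙ (hξ.1.toLp ξ - hζ.toLp ζ))ᗮ := by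
    refine Submodule.topologicalClosure_minimal _ (Submodule.span_le.2 ?_)
      (Submodule.isClosed_orthogonal _)
    rintro f ⟨φ, hφ, hs, hf⟩
    rw [SetLike.mem_coe, Submodule.mem_orthogonal_singleton_iff_inner_right, L2.inner_def]
    refine (integral_congr_ae ?_).trans (integral_inner_sub_gradient_eq_zero hζ hU hξ hφ hs)
    filter_upwards [hf, Lp.coeFn_sub (hξ.1.toLp ξ) (hζ.toLp ζ), hξ.1.coeFn_toLp, hζ.coeFn_toLp]
      with x h1 h2 h3 h4
    rw [h1, h2, Pi.sub_apply, h3, h4]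
  have horth := (Submodule.mem_orthogonal_singleton_iff_inner_left).1 (hle hT)
  have h1 : ‖hζ.toLp ζ‖ ≤ ‖hξ.1.toLp ξ‖ := by
    have h2 := norm_add_sq_eq_norm_sq_add_norm_sq_of_inner_eq_zero _ _ horth
    rw [add_sub_cancel] at h2
    nlinarith [norm_nonneg (hζ.toLp ζ), norm_nonneg (hξ.1.toLp ξ),
      norm_nonneg (hξ.1.toLp ξ - hζ.toLp ζ)]
  rw [Lp.norm_toLp, Lp.norm_toLp] at h1
  exact (ENNReal.toReal_le_toReal hζ.2.ne hξ.1.2.ne).1 h1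

/-! ### Gradients of linear growth are tangent -/

lemma isClosed_tangentSpace (m : P2 d) : IsClosed (tangentSpace m : Set (Lp (E d) 2 m.meas)) :=
  Submodule.isClosed_topologicalClosure _

/-- Membership in the tangent space is preserved by `L²` limits. -/
lemma toLp_mem_tangentSpace_of_tendsto {m : P2 d} {ι : Type*} {l : Filter ι} [l.NeBot]
    {v : E d → E d} (hv : MemLp v 2 m.meas) {w : ι → E d → E d}
    (hw : ∀ i, MemLp (w i) 2 m.meas) (hmem : ∀ᶠ i in l, (hw i).toLp (w i) ∈ tangentSpace m)
    (hlim : Tendsto (fun i => eLpNorm (w i - v) 2 m.meas) l (𝓝 0)) :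
    hv.toLp v ∈ tangentSpace m := by
  refine (isClosed_tangentSpace m).mem_of_tendsto (b := l) (f := fun i => (hw i).toLp (w i)) ?_ hmem
  exact (Lp.tendsto_Lp_iff_tendsto_eLpNorm'' w hw v hv).2 hlim

lemma toLp_mem_tangentSpace_of_tendstoUniformly {m : P2 d} {ι : Type*} {l : Filter ι} [l.NeBot]
    {v : E d → E d} (hv : MemLp v 2 m.meas) {w : ι → E d → E d}
    (hw : ∀ i, MemLp (w i) 2 m.meas) (hmem : ∀ᶠ i in l, (hw i).toLp (w i) ∈ tangentSpace m)
    (hlim : TendstoUniformly w v l) :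
    hv.toLp v ∈ tangentSpace m := by
  refine toLp_mem_tangentSpace_of_tendsto hv hw hmem ?_
  rw [ENNReal.tendsto_nhds_zero]
  intro ε hε
  obtain ⟨δ, hδ0, hδ⟩ : ∃ δ : ℝ, 0 < δ ∧ ENNReal.ofReal δ ≤ ε := by
    rcases eq_or_ne ε ⊤ with rfl | h
    · exact ⟨1, one_pos, le_top⟩
    · exact ⟨ε.toReal, ENNReal.toReal_pos hε.ne' h, (ENNReal.ofReal_toReal h).le⟩
  filter_upwards [Metric.tendstoUniformly_iff.1 hlim δ hδ0] with i hi
  refine (eLpNorm_le_of_ae_bound (C := δ) (Eventually.of_forall fun x => ?_)).trans ?_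
  · have := hi x
    rw [dist_comm, dist_eq_norm] at this
    exact this.le
  · simpa using hδ

lemma toLp_gradient_mem_tangentSpace_of_contDiff {m : P2 d} {φ : E d → ℝ} (hφ : ContDiff ℝ ∞ φ)
    (hs : HasCompactSupport φ) (h : MemLp (gradient φ) 2 m.meas) :
    h.toLp (gradient φ) ∈ tangentSpace m :=
  Submodule.le_topologicalClosure _ (Submodule.subset_span ⟨φ, hφ, hs, h.coeFn_toLp⟩)

/-- Gradients of compactly supported `C¹` functions belong to the tangent space. -/
lemma toLp_gradient_mem_tangentSpace {m : P2 d} {ψ : E d → ℝ} (hψ : ContDiff ℝ 1 ψ)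
    (hs : HasCompactSupport ψ) (h : MemLp (gradient ψ) 2 m.meas) :
    h.toLp (gradient ψ) ∈ tangentSpace m := by
  let δ : ℕ → ContDiffBump (0 : E d) := fun n =>
    { rIn := 1 / (2 * (n + 1)), rOut := 1 / (n + 1), rIn_pos := by positivity
      rIn_lt_rOut := by
        refine one_div_lt_one_div_of_lt (by positivity) ?_
        have : (0 : ℝ) < n + 1 := by positivity
        linarith }
  let φ : ℕ → E d → ℝ := fun n =>
    convolution ((δ n).normed volume) ψ (ContinuousLinearMap.lsmul ℝ ℝ) volume
  have hφ : ∀ n, ContDiff ℝ ∞ (φ n) := fun n =>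
    (δ n).hasCompactSupport_normed.contDiff_convolution_left _ (δ n).contDiff_normed
      (hψ.continuous.locallyIntegrable)
  have hφs : ∀ n, HasCompactSupport (φ n) := fun n =>
    HasCompactSupport.convolution _ (δ n).hasCompactSupport_normed hs
  have hw : ∀ n, MemLp (gradient (φ n)) 2 m.meas := fun n =>
    memLp_of_continuous_hasCompactSupport (contDiff_gradient (hφ n)).continuous
      (hasCompactSupport_gradient (hφs n)) m
  refine toLp_mem_tangentSpace_of_tendstoUniformly (l := atTop) h hw
    (Eventually.of_forall fun n => toLp_gradient_mem_tangentSpace_of_contDiff (hφ n) (hφs n) _) ?_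
  -- The derivative of the mollification is the mollified derivative; compact support makes `fderiv
  -- ℝ ψ` uniformly continuous, so the convergence is uniform.
  have hfc : Continuous (fderiv ℝ ψ) := hψ.continuous_fderiv (by simp)
  have huc : UniformContinuous (fderiv ℝ ψ) :=
    (hs.fderiv ℝ).uniformContinuous_of_continuous hfc
  rw [Metric.tendstoUniformly_iff]
  intro ε hε
  obtain ⟨η, hη0, hη⟩ := Metric.uniformContinuous_iff.1 huc (ε / 2) (half_pos hε)
  have hlim := (tendsto_one_div_add_atTop_nhds_zero_nat (𝕜 := ℝ)).eventually_lt_const hη0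
  filter_upwards [hlim] with n hn x
  have h1 : HasFDerivAt (φ n) (convolution ((δ n).normed volume) (fderiv ℝ ψ)
      (ContinuousLinearMap.lsmul ℝ ℝ) volume x) x :=
    hs.hasFDerivAt_convolution_right (ContinuousLinearMap.lsmul ℝ ℝ)
      ((δ n).continuous_normed.locallyIntegrable) hψ x
  have h2 := (δ n).dist_normed_convolution_le (μ := volume) (g := fderiv ℝ ψ) (x₀ := x)
    (ε := ε / 2) hfc.aestronglyMeasurable (fun y hy => (hη (lt_trans hy hn)).le)
  rw [gradient, gradient, LinearIsometryEquiv.dist_map, h1.fderiv, dist_comm]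
  exact h2.trans_lt (half_lt_self hε)

lemma memLp_const_mul_one_add_norm (m : P2 d) (C : ℝ) :
    MemLp (fun x : E d => C * (1 + ‖x‖)) 2 m.meas := by
  have h1 : MemLp (fun x : E d => ‖x‖) 2 m.meas := (memLp_id m).norm
  have h2 : MemLp (fun x : E d => 1 + ‖x‖) 2 m.meas := (memLp_const (1 : ℝ)).add h1
  exact h2.const_mul C

lemma memLp_of_linear_growth (m : P2 d) {v : E d → E d} (hv : Continuous v) {C : ℝ}
    (hC : ∀ x, ‖v x‖ ≤ C * (1 + ‖x‖)) : MemLp v 2 m.meas :=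
  (memLp_const_mul_one_add_norm m C).mono' hv.aestronglyMeasurable (Eventually.of_forall hC)

lemma eLpNorm_two_sq {F : Type*} [NormedAddCommGroup F] (μ : Measure (E d)) (u : E d → F) :
    eLpNorm u 2 μ ^ 2 = ∫⁻ x, ‖u x‖ₑ ^ 2 ∂μ := by
  have h := eLpNorm_nnreal_pow_eq_lintegral (μ := μ) (f := u) (p := 2) (by norm_num)
  simpa only [ENNReal.coe_ofNat, NNReal.coe_ofNat, ENNReal.rpow_ofNat] using h

lemma tendsto_eLpNorm_two_of_dominated {μ : Measure (E d)} {u : ℕ → E d → E d} {b : E d → ℝ}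
    (hu : ∀ n, AEStronglyMeasurable (u n) μ) (hb : MemLp b 2 μ) (hub : ∀ n x, ‖u n x‖ ≤ b x)
    (hlim : ∀ x, Tendsto (fun n => u n x) atTop (𝓝 0)) :
    Tendsto (fun n => eLpNorm (u n) 2 μ) atTop (𝓝 0) := by
  have hbd : ∫⁻ x, ‖b x‖ₑ ^ 2 ∂μ ≠ ⊤ := by
    rw [← eLpNorm_two_sq]
    exact (ENNReal.pow_lt_top hb.2).ne
  have h1 : Tendsto (fun n => eLpNorm (u n) 2 μ ^ 2) atTop (𝓝 0) := by
    simp only [eLpNorm_two_sq]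
    rw [← lintegral_zero (μ := μ)]
    refine tendsto_lintegral_of_dominated_convergence' (fun x => ‖b x‖ₑ ^ 2) (fun n => ?_)
      (fun n => ?_) hbd ?_
    · exact (hu n).enorm.pow_const 2
    · refine Eventually.of_forall fun x => ?_
      exact pow_le_pow_left' (enorm_le_iff_norm_le.2 ((hub n x).trans (le_abs_self _))) 2
    · refine Eventually.of_forall fun x => ?_
      have h2 := ((ENNReal.continuous_pow 2).comp continuous_enorm).tendsto (0 : E d)
      simpa [Function.comp_def] using h2.comp (hlim x)
  have h2 := h1.ennrpow_const (1 / 2 : ℝ)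
  refine (h2.congr fun n => ?_).trans_eq (by simp)
  rw [← ENNReal.rpow_ofNat, ← ENNReal.rpow_mul]
  simp

/-- The bound on `‖x‖ ‖∇χ(x)‖` is invariant under dilation, so one `M` serves all the cutoffs `χ(c
·)`. -/
lemma exists_radial_cutoff : ∃ (χ : E d → ℝ) (M : ℝ), ContDiff ℝ ∞ χ ∧ HasCompactSupport χ ∧
    (∀ x, ‖x‖ < 1 → χ x = 1) ∧ (∀ x, |χ x| ≤ 1) ∧ ∀ x, ‖x‖ * ‖fderiv ℝ χ x‖ ≤ M := by
  let χ : ContDiffBump (0 : E d) := ⟨1, 2, one_pos, one_lt_two⟩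
  have h1 : Continuous (fun x => ‖x‖ * ‖fderiv ℝ χ x‖) :=
    continuous_norm.mul (χ.contDiff.continuous_fderiv (n := ∞) (by simp)).norm
  obtain ⟨M, hM⟩ := h1.bounded_above_of_compact_support
    ((χ.hasCompactSupport.fderiv ℝ).norm.mul_left)
  refine ⟨χ, M, χ.contDiff, χ.hasCompactSupport, fun x hx => ?_, fun x => ?_, fun x => ?_⟩
  · exact χ.one_of_mem_closedBall (by simpa using hx.le)
  · rw [abs_of_nonneg χ.nonneg]
    exact χ.le_one
  · exact (le_abs_self _).trans (hM x)

lemma abs_le_of_hasGradientAt_of_growth {ψ : E d → ℝ} {v : E d → E d}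
    (hψ : ∀ x, HasGradientAt ψ (v x) x) (h0 : ψ 0 = 0) {C : ℝ} (hC0 : 0 ≤ C)
    (hC : ∀ x, ‖v x‖ ≤ C * (1 + ‖x‖)) (x : E d) : |ψ x| ≤ C * (1 + ‖x‖) * ‖x‖ := by
  have := (convex_segment (0 : E d) x).norm_image_sub_le_of_norm_hasFDerivWithin_le
    (f := ψ) (C := C * (1 + ‖x‖)) (fun y _ => (hψ y).hasFDerivAt.hasFDerivWithinAt)
    (fun y hy => by
      rw [LinearIsometryEquiv.norm_map]
      refine (hC y).trans ?_
      gcongr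
      simpa using norm_sub_le_of_mem_segment hy)
    (left_mem_segment ℝ _ _) (right_mem_segment ℝ _ _)
  simpa [h0] using this

lemma gradient_comp_smul_mul {χ ψ : E d → ℝ} (hχ : Differentiable ℝ χ) {v x : E d}
    (hψ : HasGradientAt ψ v x) (c : ℝ) :
    gradient (fun x => χ (c • x) * ψ x) x - v =
      (χ (c • x) - 1) • v + (ψ x * c) • gradient χ (c • x) := by
  have h1 : HasFDerivAt (fun x => χ (c • x)) (c • fderiv ℝ χ (c • x)) x := by
    have := (hχ (c • x)).hasFDerivAt.comp x ((hasFDerivAt_id x).const_smul c)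
    rwa [ContinuousLinearMap.comp_smul, ContinuousLinearMap.comp_id] at this
  have h2 : HasGradientAt (fun x => χ (c • x) * ψ x)
      (χ (c • x) • v + (ψ x * c) • gradient χ (c • x)) x := by
    rw [hasGradientAt_iff_hasFDerivAt, map_add, map_smul, map_smul, gradient,
      LinearIsometryEquiv.apply_symm_apply, mul_smul]
    exact h1.mul hψ.hasFDerivAt
  rw [h2.gradient]
  module

/-- The potential grows quadratically, but one factor `‖x‖` is absorbed by the dilation-invariant
bound on `∇χ`. The resulting majorant is independent of `c` and square integrable. -/
lemma norm_gradient_comp_smul_mul_sub_le {χ ψ : E d → ℝ} (hχ : Differentiable ℝ χ)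
    (hχle : ∀ x, |χ x| ≤ 1) {M : ℝ} (hχM : ∀ x, ‖x‖ * ‖fderiv ℝ χ x‖ ≤ M) {v : E d → E d}
    (hψ : ∀ x, HasGradientAt ψ (v x) x) (h0 : ψ 0 = 0) {C : ℝ} (hC0 : 0 ≤ C)
    (hC : ∀ x, ‖v x‖ ≤ C * (1 + ‖x‖)) {c : ℝ} (hc : 0 ≤ c) (x : E d) :
    ‖gradient (fun x => χ (c • x) * ψ x) x - v x‖ ≤ (2 * C + C * M) * (1 + ‖x‖) := by
  have hψle := abs_le_of_hasGradientAt_of_growth hψ h0 hC0 hC x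
  rw [gradient_comp_smul_mul hχ (hψ x), add_mul]
  refine (norm_add_le _ _).trans (add_le_add ?_ ?_)
  · rw [norm_smul, mul_assoc]
    refine mul_le_mul ?_ (hC x) (norm_nonneg _) (by norm_num)
    refine (norm_sub_le _ _).trans ?_
    rw [norm_one, Real.norm_eq_abs]
    linarith [hχle (c • x)]
  · rw [norm_smul, norm_mul, Real.norm_eq_abs, Real.norm_eq_abs, abs_of_nonneg hc, gradient,
      LinearIsometryEquiv.norm_map]
    have h1 := hχM (c • x)
    rw [norm_smul, Real.norm_eq_abs, abs_of_nonneg hc] at h1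
    calc |ψ x| * c * ‖fderiv ℝ χ (c • x)‖
        ≤ C * (1 + ‖x‖) * ‖x‖ * c * ‖fderiv ℝ χ (c • x)‖ := by gcongr
      _ = C * (1 + ‖x‖) * (c * ‖x‖ * ‖fderiv ℝ χ (c • x)‖) := by ring
      _ ≤ C * (1 + ‖x‖) * M := by gcongr
      _ = C * M * (1 + ‖x‖) := by ring

lemma contDiff_one_of_hasGradientAt {ψ : E d → ℝ} {v : E d → E d} (hv : Continuous v)
    (hψ : ∀ x, HasGradientAt ψ (v x) x) : ContDiff ℝ 1 ψ := by
  rw [contDiff_one_iff_fderiv]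
  refine ⟨fun x => (hψ x).differentiableAt, ?_⟩
  have : fderiv ℝ ψ = fun x => InnerProductSpace.toDual ℝ (E d) (v x) := by
    funext x
    exact (hψ x).hasFDerivAt.fderiv
  rw [this]
  fun_prop

lemma toLp_gradient_comp_smul_mul_mem_tangentSpace (m : P2 d) {χ ψ : E d → ℝ}
    (hχ : ContDiff ℝ ∞ χ) (hχs : HasCompactSupport χ) (hψ : ContDiff ℝ 1 ψ) {c : ℝ} (hc : 0 < c) :
    ∃ h : MemLp (gradient fun x => χ (c • x) * ψ x) 2 m.meas,
      h.toLp (gradient fun x => χ (c • x) * ψ x) ∈ tangentSpace m := by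
  have hf : ContDiff ℝ 1 (fun x => χ (c • x) * ψ x) :=
    ((hχ.of_le (by simp)).comp (contDiff_const_smul c)).mul hψ
  have hfs : HasCompactSupport (fun x => χ (c • x) * ψ x) :=
    (hχs.comp_homeomorph (Homeomorph.smulOfNeZero c hc.ne')).mul_right
  have hgc : Continuous (gradient fun x => χ (c • x) * ψ x) :=
    (InnerProductSpace.toDual ℝ (E d)).symm.continuous.comp (hf.continuous_fderiv (by simp))
  exact ⟨memLp_of_continuous_hasCompactSupport hgc (hasCompactSupport_gradient hfs) m,
    toLp_gradient_mem_tangentSpace hf hfs _⟩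

lemma toLp_mem_tangentSpace_of_hasGradientAt_of_zero {m : P2 d} {ψ : E d → ℝ} {v : E d → E d}
    (hv : Continuous v) (hψ : ∀ x, HasGradientAt ψ (v x) x) (h0 : ψ 0 = 0) {C : ℝ}
    (hC : ∀ x, ‖v x‖ ≤ C * (1 + ‖x‖)) (h : MemLp v 2 m.meas) : h.toLp v ∈ tangentSpace m := by
  obtain ⟨χ, M, hχ, hχs, hχ1, hχle, hχM⟩ := exists_radial_cutoff (d := d)
  have hχd : Differentiable ℝ χ := hχ.differentiable (by simp)
  have hC0 : 0 ≤ C := by simpa using (norm_nonneg _).trans (hC 0)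
  obtain ⟨c, hc0, hc⟩ : ∃ c : ℕ → ℝ, (∀ n, 0 < c n) ∧ Tendsto c atTop (𝓝 0) :=
    ⟨fun n => 1 / ((n : ℝ) + 1), fun n => by positivity, tendsto_one_div_add_atTop_nhds_zero_nat⟩
  choose hw hmem using fun n => toLp_gradient_comp_smul_mul_mem_tangentSpace m hχ hχs
    (contDiff_one_of_hasGradientAt hv hψ) (hc0 n)
  refine toLp_mem_tangentSpace_of_tendsto (l := atTop) h hw (Eventually.of_forall hmem) ?_
  refine tendsto_eLpNorm_two_of_dominated (b := fun x => (2 * C + C * M) * (1 + ‖x‖))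
    (fun n => ((hw n).sub h).1)
    (memLp_const_mul_one_add_norm m _)
    (fun n x => norm_gradient_comp_smul_mul_sub_le hχd hχle hχM hψ h0 hC0 hC (hc0 n).le x)
    fun x => ?_
  have h1 : Tendsto (fun n => c n * ‖x‖) atTop (𝓝 0) := by
    simpa using hc.mul_const ‖x‖
  -- For fixed `x` the error vanishes exactly once `c n * ‖x‖ < 1`: the cutoff is then 1 near `c n •
  -- x`.
  refine tendsto_const_nhds.congr' ?_
  filter_upwards [h1.eventually_lt_const one_pos] with n hn
  have hx : ‖c n • x‖ < 1 := by
    rwa [norm_smul, Real.norm_eq_abs, abs_of_pos (hc0 n)]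
  have h2 : χ =ᶠ[𝓝 (c n • x)] fun _ => 1 := by
    filter_upwards [(isOpen_lt continuous_norm continuous_const).mem_nhds hx] with y hy
      using hχ1 y hy
  rw [Pi.sub_apply, gradient_comp_smul_mul hχd (hψ x), hχ1 _ hx, gradient, h2.fderiv_eq]
  simp

/-- Gradients of `C¹` functions belong to the tangent space if they are of linear growth. -/
lemma toLp_mem_tangentSpace_of_hasGradientAt {m : P2 d} {ψ : E d → ℝ} {v : E d → E d}
    (hv : Continuous v) (hψ : ∀ x, HasGradientAt ψ (v x) x) {C : ℝ}
    (hC : ∀ x, ‖v x‖ ≤ C * (1 + ‖x‖)) (h : MemLp v 2 m.meas) : h.toLp v ∈ tangentSpace m :=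
  toLp_mem_tangentSpace_of_hasGradientAt_of_zero (ψ := fun x => ψ x - ψ 0) hv
    (fun x => hasGradientAt_iff_hasFDerivAt.2 ((hψ x).hasFDerivAt.sub_const (ψ 0)))
    (sub_self _) hC h

/-- Poincaré lemma: symmetry says that the 1-form `⟨v, ·⟩` is closed, and the whole space is convex.
-/
lemma exists_hasGradientAt_of_symmetric {v : E d → E d} (hv : Differentiable ℝ v)
    (hsymm : ∀ x u w, inner ℝ (fderiv ℝ v x u) w = inner ℝ (fderiv ℝ v x w) u) :
    ∃ ψ : E d → ℝ, ∀ x, HasGradientAt ψ (v x) x := by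
  let J : E d ≃L[ℝ] StrongDual ℝ (E d) := (InnerProductSpace.toDual ℝ (E d)).toContinuousLinearEquiv
  have hω : ∀ x, HasFDerivAt (fun x => J (v x)) ((J : E d →L[ℝ] StrongDual ℝ (E d)).comp
      (fderiv ℝ v x)) x := fun x => J.hasFDerivAt.comp x (hv x).hasFDerivAt
  obtain ⟨ψ, hψ⟩ := convex_univ.exists_forall_hasFDerivAt_of_fderiv_symmetric isOpen_univ
    (fun x _ => (hω x).differentiableAt.differentiableWithinAt) (fun x _ u w => by
      rw [(hω x).fderiv]
      exact hsymm x u w)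
  exact ⟨ψ, fun x => hψ x (mem_univ x)⟩

/-! ### Moving an atom, and symmetry of the spatial derivative -/

/-- The measure `a m + b δ_z`. -/
def P2.addAtom (m : P2 d) (a b : ℝ≥0) (h : a + b = 1) (z : E d) : P2 d where
  meas := a • m.meas + b • Measure.dirac z
  isProb := ⟨by simp [← ENNReal.coe_add, h]⟩
  secondMoment := by
    rw [lintegral_add_measure, lintegral_smul_measure, lintegral_smul_measure, lintegral_dirac]
    refine ENNReal.add_lt_top.2 ⟨?_, ?_⟩
    · exact ENNReal.mul_lt_top ENNReal.coe_lt_top m.secondMoment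
    · exact ENNReal.mul_lt_top ENNReal.coe_lt_top (by finiteness)

/-- The plan that moves the atom of `a m + b δ_z` from `z` to `z'`. -/
def atomPlan (m : P2 d) (a b : ℝ≥0) (z z' : E d) : Measure (E d × E d) :=
  a • m.meas.map (fun x => (x, x)) + b • Measure.dirac (z, z')

section atom

variable (m : P2 d) {a b : ℝ≥0} (h : a + b = 1)

lemma atomPlan_mem_couplings (z z' : E d) :
    atomPlan m a b z z' ∈ couplings (m.addAtom a b h z) (m.addAtom a b h z') := by
  constructor
  · rw [Measure.fst, atomPlan, Measure.map_add _ _ measurable_fst, Measure.map_smul,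
      Measure.map_smul, Measure.map_dirac' measurable_fst,
      Measure.map_map (by fun_prop) (by fun_prop)]
    exact congrArg (fun ν => a • ν + b • Measure.dirac z) Measure.map_id
  · rw [Measure.snd, atomPlan, Measure.map_add _ _ measurable_snd, Measure.map_smul,
      Measure.map_smul, Measure.map_dirac' measurable_snd,
      Measure.map_map (by fun_prop) (by fun_prop)]
    exact congrArg (fun ν => a • ν + b • Measure.dirac z') Measure.map_id

/-- Only the moving atom is off the diagonal, where `f` vanishes; hence no integrability of `f` has
to be assumed. -/
lemma integral_atomPlan {F : Type*} [NormedAddCommGroup F] [NormedSpace ℝ F] [CompleteSpace F]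
    {f : E d × E d → F} (hf : StronglyMeasurable f) (hf0 : ∀ x, f (x, x) = 0) (z z' : E d) :
    ∫ p, f p ∂atomPlan m a b z z' = (b : ℝ) • f (z, z') := by
  have hm : Measurable (fun x : E d => (x, x)) := by fun_prop
  have hae : f =ᵐ[m.meas.map (fun x => (x, x))] 0 := by
    refine (ae_map_iff hm.aemeasurable ?_).2 (Eventually.of_forall hf0)
    exact hf.measurableSet_eq_fun stronglyMeasurable_zero
  have h1 : Integrable f (a • m.meas.map (fun x => (x, x))) :=
    (((integrable_zero _ _ _).congr hae.symm)).smul_measure_nnreal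
  have h2 : Integrable f (b • Measure.dirac (z, z')) :=
    (integrable_dirac' hf (by finiteness)).smul_measure_nnreal
  rw [atomPlan, integral_add_measure h1 h2, integral_smul_nnreal_measure,
    integral_smul_nnreal_measure, integral_congr_ae hae, integral_dirac' _ _ hf]
  simp [NNReal.smul_def]

lemma integral_norm_sub_sq_atomPlan (z z' : E d) :
    ∫ p, ‖p.1 - p.2‖ ^ 2 ∂atomPlan m a b z z' = b * ‖z - z'‖ ^ 2 := by
  refine integral_atomPlan m (f := fun p => ‖p.1 - p.2‖ ^ 2) ?_ (by simp) z z'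
  exact Continuous.stronglyMeasurable (by fun_prop)

lemma pairing_atomPlan {ζ : E d → E d} (hζ : Continuous ζ) (z z' : E d) :
    pairing ζ (atomPlan m a b z z') = b * inner ℝ (ζ z) (z' - z) := by
  refine integral_atomPlan m (f := fun p => inner ℝ (ζ p.1) (p.2 - p.1)) ?_ (by simp) z z'
  exact Continuous.stronglyMeasurable (by fun_prop)

lemma linPart_atomPlan (D : E d → E d →L[ℝ] E d) {B : E d → E d → E d →L[ℝ] E d} {x : E d}
    (hB : Continuous (B x)) (z z' y : E d) :
    linPart D B (atomPlan m a b z z') x y = D x (y - x) + (b : ℝ) • B x z (z' - z) := by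
  rw [linPart, integral_atomPlan m (f := fun p => B x p.1 (p.2 - p.1)) ?_ (by simp) z z']
  exact Continuous.stronglyMeasurable (by fun_prop)

lemma tendsto_addAtom (x : E d) :
    Tendsto (m.addAtom a b h) (𝓝 x) (𝓝 (m.addAtom a b h x)) := by
  rw [tendsto_nhds_iff_W2]
  have h1 : Tendsto (fun z => √(b * ‖x - z‖ ^ 2)) (𝓝 x) (𝓝 0) := by
    have : Continuous (fun z => √(b * ‖x - z‖ ^ 2)) := by fun_prop
    simpa using this.tendsto x
  refine squeeze_zero (fun z => W2_nonneg _ _) (fun z => Real.le_sqrt_of_sq_le ?_) h1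
  exact (W2_sq_le_integral (atomPlan_mem_couplings m h x z)).trans_eq
    (integral_norm_sub_sq_atomPlan m x z)

/-- If `m` does not charge the ball of radius `r` around `x`, moving the atom within the ball of
radius `r / 4` is optimal. -/
lemma atomPlan_mem_optCouplings {x z z' : E d} {r : ℝ} (hm : ∀ᵐ y ∂m.meas, r ≤ ‖y - x‖)
    (hz : ‖z - x‖ ≤ r / 4) (hz' : ‖z' - x‖ ≤ r / 4) :
    atomPlan m a b z z' ∈ optCouplings (m.addAtom a b h z) (m.addAtom a b h z') := by
  refine mem_optCouplings_of_forall_le (atomPlan_mem_couplings m h z z') fun γ hγ => ?_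
  have hsnd : ∀ᵐ y ∂(m.addAtom a b h z').meas, r ≤ ‖y - x‖ ∨ y = z' := by
    refine ae_add_measure_iff.2 ⟨?_, ?_⟩
    · exact Measure.ae_smul_measure (hm.mono fun y => Or.inl) a
    · refine Measure.ae_smul_measure ?_ b
      rw [ae_dirac_eq]
      exact Or.inr rfl
  have hsnd' := (measurePreserving_snd_of_mem_couplings hγ).quasiMeasurePreserving.ae hsnd
  -- Any plan takes mass at least `b` out of `z`. It lands at `z'` or outside the ball of radius
  -- `r`, thus at distance at least `3r/4` from `z`, while `‖z - z'‖ ≤ r/2`.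
  have hle : ∀ᵐ p ∂γ, (Prod.fst ⁻¹' {z}).indicator (fun _ => ‖z - z'‖ₑ ^ 2) p
      ≤ ‖p.1 - p.2‖ₑ ^ 2 := by
    filter_upwards [hsnd'] with p hp
    refine indicator_apply_le' (fun hp1 => ?_) (fun _ => bot_le)
    have hp1 : p.1 = z := hp1
    refine pow_le_pow_left' (enorm_le_iff_norm_le.2 ?_) 2
    rw [hp1]
    rcases hp with hp | hp
    · have h1 := norm_sub_le_norm_sub_add_norm_sub z x z'
      have h2 := norm_sub_le_norm_sub_add_norm_sub p.2 z x
      rw [norm_sub_rev x z'] at h1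
      rw [norm_sub_rev p.2 z] at h2
      linarith [norm_nonneg (z - x)]
    · rw [hp]
  calc cost (atomPlan m a b z z') = ENNReal.ofReal (b * ‖z - z'‖ ^ 2) := by
        rw [cost_eq_ofReal_integral (atomPlan_mem_couplings m h z z'),
          integral_norm_sub_sq_atomPlan]
    _ = ‖z - z'‖ₑ ^ 2 * b := by
        rw [mul_comm, ENNReal.ofReal_mul (by positivity), ENNReal.ofReal_pow (norm_nonneg _),
          ofReal_norm, ENNReal.ofReal_coe_nnreal]
    _ ≤ ‖z - z'‖ₑ ^ 2 * γ (Prod.fst ⁻¹' {z}) := by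
        gcongr
        rw [← Measure.fst_apply (measurableSet_singleton z), hγ.1]
        simp [P2.addAtom]
    _ = ∫⁻ p, (Prod.fst ⁻¹' {z}).indicator (fun _ => ‖z - z'‖ₑ ^ 2) p ∂γ := by
        rw [lintegral_indicator_const (measurable_fst (measurableSet_singleton z))]
    _ ≤ cost γ := lintegral_mono_ae hle

end atom

lemma hasFDerivAt_of_norm_sub_le_sq {F G : Type*} [NormedAddCommGroup F] [NormedSpace ℝ F]
    [NormedAddCommGroup G] [NormedSpace ℝ G] {f : F → G} {f' : F →L[ℝ] G} {x : F} {C : ℝ}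
    (h : ∀ᶠ y in 𝓝 x, ‖f y - f x - f' (y - x)‖ ≤ C * ‖y - x‖ ^ 2) : HasFDerivAt f f' x := by
  rw [hasFDerivAt_iff_isLittleO]
  refine Asymptotics.IsBigO.trans_isLittleO (g := fun y => ‖y - x‖ ^ 2)
    (Asymptotics.IsBigO.of_bound C ?_) ?_
  · simpa using h
  · have h1 := (Asymptotics.isLittleO_norm_pow_id (E' := F) one_lt_two).comp_tendsto
      (k := fun y => y - x) (l' := 𝓝 x) (by
        have : Continuous (fun y => y - x) := by fun_prop
        simpa using this.tendsto x)
    exact h1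

/-- Symmetry of the second derivative of `z ↦ U (a m + b δ_z)`. -/
lemma symmetric_of_atom {U : P2 d → ℝ} {g : P2 d → E d → E d} {O : Set (P2 d)} {C : P2 d → ℝ}
    (hO : IsOpen O) (hg : ∀ m ∈ O, Continuous (g m))
    (h1 : ∀ m ∈ O, ∀ ν ∈ O, ∀ γ ∈ optCouplings m ν,
      |U ν - U m - pairing (g m) γ| ≤ C m * W2 m ν ^ 2)
    (m : P2 d) {a b : ℝ≥0} (h : a + b = 1) (hb : 0 < b) {x : E d} {r : ℝ} (hr : 0 < r)
    (hm : ∀ᵐ y ∂m.meas, r ≤ ‖y - x‖) (hmO : m.addAtom a b h x ∈ O)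
    {D : E d → E d →L[ℝ] E d} {B : E d → E d → E d →L[ℝ] E d} (hB : Continuous (B x))
    (h2 : ∀ ν ∈ O, ∀ γ ∈ optCouplings (m.addAtom a b h x) ν, ∀ y z,
      ‖g ν z - g (m.addAtom a b h x) y - linPart D B γ y z‖ ≤
        C (m.addAtom a b h x) * (‖y - z‖ ^ 2 + W2 (m.addAtom a b h x) ν ^ 2)) (u w : E d) :
    inner ℝ (D x u + (b : ℝ) • B x x u) w = inner ℝ (D x w + (b : ℝ) • B x x w) u := by
  set M : E d → P2 d := m.addAtom a b h
  have hev : ∀ᶠ z in 𝓝 x, M z ∈ O ∧ ‖z - x‖ ≤ r / 4 := by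
    refine ((tendsto_addAtom m h x).eventually (hO.mem_nhds hmO)).and ?_
    filter_upwards [Metric.closedBall_mem_nhds x (show 0 < r / 4 by positivity)] with z hz
    rwa [Metric.mem_closedBall, dist_eq_norm] at hz
  have hx : M x ∈ O ∧ ‖x - x‖ ≤ r / 4 := hev.self_of_nhds
  have hW : ∀ z z', ‖z - x‖ ≤ r / 4 → ‖z' - x‖ ≤ r / 4 →
      W2 (M z) (M z') ^ 2 = b * ‖z' - z‖ ^ 2 := fun z z' hz hz' => by
    rw [W2_sq_eq_integral (atomPlan_mem_optCouplings m h hm hz hz'),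
      integral_norm_sub_sq_atomPlan, norm_sub_rev]
  let J : E d ≃L[ℝ] StrongDual ℝ (E d) := (InnerProductSpace.toDual ℝ (E d)).toContinuousLinearEquiv
  have hJ : ∀ v w, J v w = inner ℝ v w := fun v w => rfl
  -- For the atom plan the pairing is `b ⟨g (M z) z, z' - z⟩` and `W2²` is `b ‖z' - z‖²`, so the
  -- first Taylor bound is differentiability in `z`.
  have hd1 : ∀ᶠ z in 𝓝 x, HasFDerivAt (fun z => U (M z)) (J ((b : ℝ) • g (M z) z)) z := by
    filter_upwards [hev, hev.eventually_nhds] with z hz hz'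
    refine hasFDerivAt_of_norm_sub_le_sq (C := C (M z) * b) ?_
    filter_upwards [hz'] with z' hz'
    have := h1 _ hz.1 _ hz'.1 _ (atomPlan_mem_optCouplings m h hm hz.2 hz'.2)
    rw [pairing_atomPlan m (hg _ hz.1), hW _ _ hz.2 hz'.2, ← mul_assoc] at this
    rwa [hJ, real_inner_smul_left]
  -- Two motions at once: the evaluation point contributes `D x`, and the atom of the measure
  -- contributes `b B x x`.
  have hd2 : HasFDerivAt (fun z => g (M z) z) (D x + (b : ℝ) • B x x) x := by
    refine hasFDerivAt_of_norm_sub_le_sq (C := C (M x) * (1 + b)) ?_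
    filter_upwards [hev] with z hz
    have := h2 _ hz.1 _ (atomPlan_mem_optCouplings m h hm hx.2 hz.2) x z
    rw [linPart_atomPlan m D hB, hW _ _ hx.2 hz.2, norm_sub_rev x z] at this
    refine this.trans_eq (by ring)
  have hd3 := J.hasFDerivAt.comp x (hd2.const_smul (b : ℝ))
  have hs := second_derivative_symmetric_of_eventually hd1 hd3 u w
  have hs' : inner ℝ ((b : ℝ) • (D x u + (b : ℝ) • B x x u)) w =
    inner ℝ ((b : ℝ) • (D x w + (b : ℝ) • B x x w)) u := hs
  rw [real_inner_smul_left, real_inner_smul_left] at hs'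
  exact mul_left_cancel₀ (by positivity) hs'

/-- The map that sends the ball of radius `r` around `x` to the point `p`. -/
def pushOut (x p : E d) (r : ℝ) (y : E d) : E d := if ‖y - x‖ < r then p else y

lemma measurable_pushOut (x p : E d) (r : ℝ) : Measurable (pushOut x p r) :=
  Measurable.ite (measurableSet_lt (by fun_prop) measurable_const) measurable_const measurable_id

lemma norm_sub_pushOut_le {x p : E d} {r : ℝ} (hp : ‖p - x‖ = r) (y : E d) :
    ‖y - pushOut x p r y‖ ≤ 2 * r := by
  unfold pushOut
  split_ifs with hy
  · have := norm_sub_le_norm_sub_add_norm_sub y x p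
    rw [norm_sub_rev x p] at this
    linarith
  · simp [← hp]

lemma le_norm_pushOut_sub {x p : E d} {r : ℝ} (hp : ‖p - x‖ = r) (y : E d) :
    r ≤ ‖pushOut x p r y - x‖ := by
  unfold pushOut
  split_ifs with hy
  · exact hp.ge
  · exact not_lt.1 hy

lemma memLp_pushOut (m : P2 d) {x p : E d} {r : ℝ} (hp : ‖p - x‖ = r) :
    MemLp (pushOut x p r) 2 m.meas := by
  have h1 : MemLp (fun y => y - pushOut x p r y) 2 m.meas :=
    MemLp.of_bound (Measurable.aestronglyMeasurable
      (measurable_id.sub (measurable_pushOut x p r))) (2 * r)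
      (Eventually.of_forall (norm_sub_pushOut_le hp))
  exact ((memLp_id m).sub h1).ae_eq (Eventually.of_forall fun y => by simp)

lemma ae_le_norm_sub_map_pushOut (m : P2 d) {x p : E d} {r : ℝ} (hp : ‖p - x‖ = r) :
    ∀ᵐ y ∂(m.map _ (memLp_pushOut m hp)).meas, r ≤ ‖y - x‖ := by
  refine (ae_map_iff (measurable_pushOut x p r).aemeasurable ?_).2
    (Eventually.of_forall (le_norm_pushOut_sub hp))
  exact measurableSet_le measurable_const (by fun_prop)

/-- Competitor plan: a fraction `a` of `m` follows `T` and the remaining fraction `b` goes to `x`.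
-/
lemma W2_sq_addAtom_map_le (m : P2 d) {T : E d → E d} (hT : MemLp T 2 m.meas) (hTm : Measurable T)
    {a b : ℝ≥0} (h : a + b = 1) (x : E d) :
    W2 m ((m.map T hT).addAtom a b h x) ^ 2 ≤
      ∫ y, ‖y - T y‖ ^ 2 ∂m.meas + b * ∫ y, ‖y - x‖ ^ 2 ∂m.meas := by
  set γ₁ := m.meas.map (fun y => (y, T y))
  set γ₂ := m.meas.map (fun y => (y, x))
  have hγ : a • γ₁ + b • γ₂ ∈ couplings m ((m.map T hT).addAtom a b h x) := by
    constructor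
    · rw [Measure.fst, Measure.map_add _ _ measurable_fst, Measure.map_smul, Measure.map_smul,
        Measure.map_map (by fun_prop) (by fun_prop), Measure.map_map (by fun_prop) (by fun_prop)]
      change a • m.meas.map id + b • m.meas.map id = m.meas
      rw [Measure.map_id, ← add_smul, h, one_smul]
    · rw [Measure.snd, Measure.map_add _ _ measurable_snd, Measure.map_smul, Measure.map_smul,
        Measure.map_map (by fun_prop) (by fun_prop), Measure.map_map (by fun_prop) (by fun_prop)]
      change a • m.meas.map T + b • m.meas.map (fun _ => x) = _
      rw [Measure.map_const, measure_univ, one_smul]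
      rfl
  have hi := integrable_add_measure.1 (integrable_norm_sub_sq hγ)
  have ha : (a : ℝ) ≤ 1 := by
    have : a ≤ 1 := h ▸ le_self_add
    exact_mod_cast this
  refine (W2_sq_le_integral hγ).trans ?_
  rw [integral_add_measure hi.1 hi.2, integral_smul_nnreal_measure, integral_smul_nnreal_measure,
    integral_map (by fun_prop) (Continuous.aestronglyMeasurable (by fun_prop)),
    integral_map (by fun_prop) (Continuous.aestronglyMeasurable (by fun_prop))]
  gcongr
  · exact mul_le_of_le_one_left (integral_nonneg fun y => by positivity) ha
  · exact le_rfl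

/-- Every measure is a limit of measures `a m' + b δ_x` with small `b`, where `m'` does not charge
a neighbourhood of `x`. -/
lemma exists_seq_addAtom [Nontrivial (E d)] (m : P2 d) (x : E d) :
    ∃ (m' : ℕ → P2 d) (a b : ℕ → ℝ≥0) (h : ∀ n, a n + b n = 1),
      (∀ n, 0 < b n) ∧ Tendsto b atTop (𝓝 0) ∧
      (∀ n, ∃ r : ℝ, 0 < r ∧ ∀ᵐ y ∂(m' n).meas, r ≤ ‖y - x‖) ∧
      Tendsto (fun n => (m' n).addAtom (a n) (b n) (h n) x) atTop (𝓝 m) := by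
  let r : ℕ → ℝ := fun n => 1 / ((n : ℝ) + 1)
  have hr0 : ∀ n, 0 < r n := fun n => by positivity
  have hr : Tendsto r atTop (𝓝 0) := tendsto_one_div_add_atTop_nhds_zero_nat
  let b : ℕ → ℝ≥0 := fun n => 1 / ((n : ℝ≥0) + 1)
  have hb0 : ∀ n, 0 < b n := fun n => by positivity
  have hb1 : ∀ n, b n ≤ 1 := fun n => by
    refine div_le_one_of_le₀ ?_ (by positivity)
    simp
  have hb : Tendsto b atTop (𝓝 0) := by
    rw [← NNReal.tendsto_coe]
    simpa [b, r] using hr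
  -- Mass within `r n` of `x` is collected at a point of the sphere of that radius, which is
  -- nonempty as the space is nontrivial; no mass travels further than `2 * r n`.
  have hp : ∀ n, ∃ p : E d, ‖p - x‖ = r n := fun n => by
    obtain ⟨e, he⟩ := exists_norm_eq (E d) (hr0 n).le
    exact ⟨x + e, by simpa using he⟩
  choose p hp using hp
  have h : ∀ n, (1 - b n) + b n = 1 := fun n => tsub_add_cancel_of_le (hb1 n)
  refine ⟨fun n => m.map _ (memLp_pushOut m (hp n)), fun n => 1 - b n, b, h, hb0, hb,
    fun n => ⟨r n, hr0 n, ae_le_norm_sub_map_pushOut m (hp n)⟩, ?_⟩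
  rw [tendsto_nhds_iff_W2]
  set K := ∫ y, ‖y - x‖ ^ 2 ∂m.meas
  have hle : ∀ n, W2 m ((m.map _ (memLp_pushOut m (hp n))).addAtom (1 - b n) (b n) (h n) x) ^ 2 ≤
      (2 * r n) ^ 2 + b n * K := fun n => by
    refine (W2_sq_addAtom_map_le m _ (measurable_pushOut _ _ _) (h n) x).trans ?_
    gcongr
    calc ∫ y, ‖y - pushOut x (p n) (r n) y‖ ^ 2 ∂m.meas ≤ ∫ _, (2 * r n) ^ 2 ∂m.meas := by
          refine integral_mono_of_nonneg (Eventually.of_forall fun y => by positivity)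
            (integrable_const _) (Eventually.of_forall fun y => ?_)
          exact pow_le_pow_left₀ (norm_nonneg _) (norm_sub_pushOut_le (hp n) y) 2
      _ = (2 * r n) ^ 2 := by simp
  have hlim : Tendsto (fun n => √((2 * r n) ^ 2 + b n * K)) atTop (𝓝 0) := by
    have h1 := ((hr.const_mul 2).pow 2).add ((NNReal.tendsto_coe.2 hb).mul_const K)
    have h2 := (Real.continuous_sqrt.tendsto _).comp h1
    simpa [Function.comp_def] using h2
  exact squeeze_zero (fun n => W2_nonneg _ _) (fun n => Real.le_sqrt_of_sq_le (hle n)) hlim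

/-- The spatial derivative of the Wasserstein gradient is symmetric. -/
lemma symmetric_of_taylor {U : P2 d → ℝ} {g : P2 d → E d → E d} {O : Set (P2 d)} {C : P2 d → ℝ}
    (hO : IsOpen O) (hg : ∀ m ∈ O, Continuous (g m))
    (h1 : ∀ m ∈ O, ∀ ν ∈ O, ∀ γ ∈ optCouplings m ν,
      |U ν - U m - pairing (g m) γ| ≤ C m * W2 m ν ^ 2)
    {D : P2 d → E d → E d →L[ℝ] E d} {B : P2 d → E d → E d → E d →L[ℝ] E d}
    (hD : ContinuousOn (fun p : E d × P2 d => D p.2 p.1) (univ ×ˢ O))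
    (hB : ∀ m ∈ O, ∀ x, Continuous (B m x)) {K : ℝ} (hBK : ∀ m ∈ O, ∀ x a, ‖B m x a‖ ≤ K)
    (h2 : ∀ m ∈ O, ∀ ν ∈ O, ∀ γ ∈ optCouplings m ν, ∀ x y,
      ‖g ν y - g m x - linPart (D m) (B m) γ x y‖ ≤ C m * (‖x - y‖ ^ 2 + W2 m ν ^ 2))
    {m : P2 d} (hm : m ∈ O) (x u w : E d) :
    inner ℝ (D m x u) w = inner ℝ (D m x w) u := by
  rcases subsingleton_or_nontrivial (E d) with hE | hE
  · rw [Subsingleton.elim u w]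
  obtain ⟨m', a, b, h, hb0, hb, hr, hlim⟩ := exists_seq_addAtom m x
  set M : ℕ → P2 d := fun n => (m' n).addAtom (a n) (b n) (h n) x
  have hMO : ∀ᶠ n in atTop, M n ∈ O := hlim.eventually (hO.mem_nhds hm)
  have hDlim : Tendsto (fun n => D (M n) x) atTop (𝓝 (D m x)) := by
    refine (hD (x, m) ⟨mem_univ _, hm⟩).tendsto.comp
      (tendsto_nhdsWithin_iff.2 ⟨tendsto_const_nhds.prodMk_nhds hlim, ?_⟩)
    filter_upwards [hMO] with n hn using ⟨mem_univ _, hn⟩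
  -- The bound `K` holds on all of `O`, so the weight `b n → 0` removes the measure derivative from
  -- the symmetric operator.
  have hBlim : Tendsto (fun n => (b n : ℝ) • B (M n) x x) atTop (𝓝 0) := by
    have h0 : Tendsto (fun n => (b n : ℝ) * K) atTop (𝓝 0) := by
      simpa using (NNReal.tendsto_coe.2 hb).mul_const K
    refine squeeze_zero_norm' ?_ h0
    filter_upwards [hMO] with n hn
    rw [norm_smul, Real.norm_of_nonneg (b n).coe_nonneg]
    gcongr
    exact hBK _ hn _ _
  have hS : Tendsto (fun n => D (M n) x + (b n : ℝ) • B (M n) x x) atTop (𝓝 (D m x)) := by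
    simpa using hDlim.add hBlim
  have hS' : ∀ v v' : E d, Tendsto
      (fun n => (inner ℝ ((D (M n) x + (b n : ℝ) • B (M n) x x) v) v' : ℝ)) atTop
      (𝓝 (inner ℝ (D m x v) v')) := fun v v' => by
    have hc : Continuous (fun T : E d →L[ℝ] E d => (inner ℝ (T v) v' : ℝ)) := by fun_prop
    exact (hc.tendsto (D m x)).comp hS
  refine tendsto_nhds_unique ((hS' u w).congr' ?_) (hS' w u)
  filter_upwards [hMO] with n hn
  obtain ⟨r, hr0, hr⟩ := hr n
  have key := symmetric_of_atom hO hg h1 (m' n) (h n) (hb0 n) hr0 hr hn (hB _ hn x) (h2 _ hn) u w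
  simpa only [add_apply, smul_apply] using key

/-! ### From quadratic approximation to the Wasserstein gradient -/

lemma pairing_neg (ζ : E d → E d) (γ : Measure (E d × E d)) : pairing (-ζ) γ = -pairing ζ γ := by
  simp [pairing, inner_neg_left, integral_neg]

lemma HasQuadraticApprox.neg {U : P2 d → ℝ} {m : P2 d} {ζ : E d → E d}
    (h : HasQuadraticApprox U m ζ) : HasQuadraticApprox (-U) m (-ζ) := by
  obtain ⟨C, hC⟩ := h
  refine ⟨C, hC.mono fun ν hν γ hγ => ?_⟩
  rw [← abs_neg, pairing_neg]
  convert hν γ hγ using 2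
  simp only [Pi.neg_apply]
  ring

lemma HasQuadraticApprox.mem_subgradients {U : P2 d → ℝ} {m : P2 d} {ζ : E d → E d}
    (h : HasQuadraticApprox U m ζ) (hζ : MemLp ζ 2 m.meas) : ζ ∈ subgradients U m := by
  obtain ⟨C, hC⟩ := h
  refine ⟨hζ, fun ε hε => ?_⟩
  have hsmall : ∀ᶠ ν in 𝓝 m, |C| * W2 m ν < ε := by
    have := (tendsto_W2_nhds m).const_mul |C|
    rw [mul_zero] at this
    exact this.eventually_lt_const hε
  filter_upwards [hC, hsmall] with ν hν hW
  obtain ⟨γ, hγ⟩ := optCouplings_nonempty m ν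
  -- A real `sInf` is informative only for sets bounded below; the approximation itself gives the
  -- bound, uniformly over optimal plans.
  have hbdd : BddBelow (pairing ζ '' optCouplings m ν) := by
    refine ⟨U ν - U m - C * W2 m ν ^ 2, ?_⟩
    rintro _ ⟨γ', hγ', rfl⟩
    linarith [(abs_le.1 (hν γ' hγ')).2]
  have h1 : sInf (pairing ζ '' optCouplings m ν) ≤ pairing ζ γ :=
    csInf_le hbdd (mem_image_of_mem _ hγ)
  have h2 : C * W2 m ν ^ 2 ≤ ε * W2 m ν := by
    calc C * W2 m ν ^ 2 ≤ |C| * W2 m ν ^ 2 := by gcongr; exact le_abs_self C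
      _ = |C| * W2 m ν * W2 m ν := by ring
      _ ≤ ε * W2 m ν := by gcongr; exact W2_nonneg _ _
  linarith [(abs_le.1 (hν γ hγ)).1]

/-- A tangent field that approximates `U` up to a quadratic error is its Wasserstein gradient. -/
lemma HasQuadraticApprox.hasGradAt {U : P2 d → ℝ} {m : P2 d} {ζ : E d → E d}
    (h : HasQuadraticApprox U m ζ) (hζ : MemLp ζ 2 m.meas) (hT : hζ.toLp ζ ∈ tangentSpace m) :
    HasGradAt U m ζ :=
  ⟨⟨⟨ζ, h.mem_subgradients hζ⟩, ⟨ζ, h.neg.mem_subgradients hζ.neg⟩⟩, h.mem_subgradients hζ,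
    fun _ hξ => eLpNorm_le_of_mem_subgradients hζ h hT hξ⟩

lemma memLp_sub_of_mem_couplings {m ν : P2 d} {γ : Measure (E d × E d)} (h : γ ∈ couplings m ν) :
    MemLp (fun p : E d × E d => p.2 - p.1) 2 γ :=
  (memLp_snd_of_mem_couplings h).sub (memLp_fst_of_mem_couplings h)

/-! ### Passage to the limit in the expansions -/

lemma tendsto_pairing {m ν : P2 d} {γ : Measure (E d × E d)} (h : γ ∈ couplings m ν)
    {f : ℕ → E d → E d} {f' : E d → E d} (hf : ∀ n, Continuous (f n)) {C : ℝ}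
    (hC : ∀ n x, ‖f n x‖ ≤ C * (1 + ‖x‖)) (hlim : ∀ x, Tendsto (fun n => f n x) atTop (𝓝 (f' x))) :
    Tendsto (fun n => pairing (f n) γ) atTop (𝓝 (pairing f' γ)) := by
  have h1 : MemLp (fun p : E d × E d => C * (1 + ‖p.1‖)) 2 γ :=
    (memLp_const_mul_one_add_norm m C).comp_measurePreserving
      (measurePreserving_fst_of_mem_couplings h)
  have h2 : MemLp (fun p : E d × E d => ‖p.2 - p.1‖) 2 γ := (memLp_sub_of_mem_couplings h).norm
  refine tendsto_integral_of_dominated_convergence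
    (fun p : E d × E d => C * (1 + ‖p.1‖) * ‖p.2 - p.1‖) (fun n => ?_) (h1.integrable_mul h2)
    (fun n => Eventually.of_forall fun p => ?_) (Eventually.of_forall fun p => ?_)
  · have := hf n
    exact Continuous.aestronglyMeasurable (by fun_prop)
  · refine (norm_inner_le_norm _ _).trans ?_
    gcongr
    exact hC n _
  · exact (hlim p.1).inner tendsto_const_nhds

lemma tendsto_clm_apply_const {T : ℕ → E d →L[ℝ] E d} {T' : E d →L[ℝ] E d}
    (h : Tendsto T atTop (𝓝 T')) (v : E d) : Tendsto (fun n => T n v) atTop (𝓝 (T' v)) :=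
  ((ContinuousLinearMap.apply ℝ (E d) v).continuous.tendsto T').comp h

lemma tendsto_linPart {m ν : P2 d} {γ : Measure (E d × E d)} (h : γ ∈ couplings m ν)
    {D : ℕ → E d → E d →L[ℝ] E d} {D' : E d → E d →L[ℝ] E d}
    {B : ℕ → E d → E d → E d →L[ℝ] E d} {B' : E d → E d → E d →L[ℝ] E d} {x : E d}
    (hD : Tendsto (fun n => D n x) atTop (𝓝 (D' x)))
    (hB : ∀ n, Continuous (B n x)) {K : ℝ} (hK : ∀ n a, ‖B n x a‖ ≤ K)
    (hlim : ∀ a, Tendsto (fun n => B n x a) atTop (𝓝 (B' x a))) (y : E d) :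
    Tendsto (fun n => linPart (D n) (B n) γ x y) atTop (𝓝 (linPart D' B' γ x y)) := by
  have := isProbabilityMeasure_of_mem_couplings h
  have h2 : Integrable (fun p : E d × E d => ‖p.2 - p.1‖) γ :=
    (memLp_sub_of_mem_couplings h).norm.integrable one_le_two
  refine (tendsto_clm_apply_const hD _).add (tendsto_integral_of_dominated_convergence
    (fun p : E d × E d => K * ‖p.2 - p.1‖) (fun n => ?_) (h2.const_mul K)
    (fun n => Eventually.of_forall fun p => ?_) (Eventually.of_forall fun p => ?_))
  · have := hB n
    exact Continuous.aestronglyMeasurable (by fun_prop)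
  · exact (B n x p.1).le_of_opNorm_le (hK n _) _
  · exact tendsto_clm_apply_const (hlim p.1) _

lemma isConcaveModulus_const_mul {c : ℝ} (hc : 0 ≤ c) : IsConcaveModulus (fun t => c * t) where
  nonneg t ht := by positivity
  cont := by fun_prop
  mono := fun s _ t _ hst => by dsimp only; gcongr
  subadd s t _ _ := by rw [mul_add]
  zero := mul_zero c
  concave := (concaveOn_id (convex_Ici 0)).smul hc

/-- Both moduli are `t ↦ |C| t`; the absolute value is there because the sign of `C` is not
prescribed. -/
lemma exists_moduli_of_quadratic_bound (C : ℝ) : ∃ ρ ε₂ : ℝ → ℝ, IsConcaveModulus ρ ∧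
    (∀ t, 0 ≤ t → 0 ≤ ε₂ t) ∧ Tendsto ε₂ (𝓝[>] 0) (𝓝 0) ∧
    ∀ s t, C * (s ^ 2 + t ^ 2) ≤ s * ρ s + t * ε₂ t := by
  refine ⟨fun t => |C| * t, fun t => |C| * t, isConcaveModulus_const_mul (abs_nonneg C),
    fun t ht => by positivity, ?_, fun s t => ?_⟩
  · have : Continuous (fun t => |C| * t) := by fun_prop
    have h1 := this.tendsto 0
    rw [mul_zero] at h1
    exact h1.mono_left nhdsWithin_le_nhds
  · nlinarith [mul_le_mul_of_nonneg_right (le_abs_self C) (show 0 ≤ s ^ 2 + t ^ 2 by positivity)]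

/-! ### Tangential rows and their uniform limits -/

/-- The rows of a field of matrices depend continuously on the matrix. -/
lemma continuous_row (i : Fin d) : Continuous (fun T : E d →L[ℝ] E d => row T i) :=
  (ContinuousLinearMap.apply ℝ (E d) (EuclideanSpace.single i 1)).continuous.comp
    (ContinuousLinearMap.adjoint (𝕜 := ℝ) (E := E d) (F := E d)).continuous

lemma norm_row_le (T : E d →L[ℝ] E d) (i : Fin d) : ‖row T i‖ ≤ ‖T‖ := by
  refine (ContinuousLinearMap.le_opNorm _ _).trans_eq ?_
  simp

lemma row_sub (S T : E d →L[ℝ] E d) (i : Fin d) : row (S - T) i = row S i - row T i := by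
  simp [row]

/-- A tangential field is its own tangential projection. -/
lemma isTangentProj_self {m : P2 d} {B : E d → E d → E d →L[ℝ] E d}
    (h : ∀ x i, ∃ h : MemLp (fun a => row (B x a) i) 2 m.meas,
      h.toLp (fun a => row (B x a) i) ∈ tangentSpace m) : IsTangentProj m B B := by
  intro x i
  obtain ⟨h1, h2⟩ := h x i
  refine ⟨h1, ?_⟩
  have : CompleteSpace (tangentSpace m) := (isClosed_tangentSpace m).completeSpace_coe
  have : tangentProj m (h1.toLp (fun a => row (B x a) i)) = h1.toLp (fun a => row (B x a) i) :=
    Submodule.starProjection_eq_self_iff.2 h2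
  rw [this]
  exact h1.coeFn_toLp

/-- All that the limit argument needs from the second order gradients: their rows lie in the range
of the projection. -/
lemma IsTangentProj.toLp_row_mem {m : P2 d} {A B : E d → E d → E d →L[ℝ] E d}
    (h : IsTangentProj m A B) (x : E d) (i : Fin d) (hB : MemLp (fun a => row (B x a) i) 2 m.meas) :
    hB.toLp (fun a => row (B x a) i) ∈ tangentSpace m := by
  obtain ⟨h1, h2⟩ := h x i
  have : CompleteSpace (tangentSpace m) := (isClosed_tangentSpace m).completeSpace_coe
  have h3 : tangentProj m (h1.toLp (fun a => row (A x a) i)) ∈ tangentSpace m :=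
    Submodule.starProjection_apply_mem _ _
  convert h3 using 1
  exact Lp.ext (hB.coeFn_toLp.trans h2.symm)

lemma tendstoUniformly_section {α β F : Type*} [UniformSpace F] {f : ℕ → β → F} {f' : β → F}
    {s : Set β} (h : TendstoUniformlyOn f f' atTop s) (k : α → β) (hk : ∀ a, k a ∈ s) :
    TendstoUniformly (fun n a => f n (k a)) (fun a => f' (k a)) atTop := by
  intro u hu
  filter_upwards [h u hu] with n hn a using hn _ (hk a)

/-- Fields with tangential rows are stable under bounded uniform limits. -/
lemma isTangentProj_of_tendstoUniformly {m : P2 d} {B : ℕ → E d → E d → E d →L[ℝ] E d}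
    {B' : E d → E d → E d →L[ℝ] E d} (hB : ∀ n, ∃ A, IsTangentProj m A (B n))
    (hBc : ∀ n x, Continuous (B n x)) {K : ℝ} (hK : ∀ n x a, ‖B n x a‖ ≤ K)
    (hlim : ∀ x, TendstoUniformly (fun n => B n x) (B' x) atTop) : IsTangentProj m B' B' := by
  refine isTangentProj_self fun x i => ?_
  have hmem : ∀ D : E d → E d →L[ℝ] E d, Continuous D → (∀ a, ‖D a‖ ≤ K) →
      MemLp (fun a => row (D a) i) 2 m.meas := fun D hD hDK =>
    MemLp.of_bound ((continuous_row i).comp hD).aestronglyMeasurable K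
      (Eventually.of_forall fun a => (norm_row_le _ i).trans (hDK a))
  have hB'c : Continuous (B' x) := (hlim x).continuous (Frequently.of_forall fun n => hBc n x)
  have hB'K : ∀ a, ‖B' x a‖ ≤ K := fun a =>
    le_of_tendsto ((hlim x).tendsto_at a).norm (Eventually.of_forall fun n => hK n x a)
  refine ⟨hmem _ hB'c hB'K, toLp_mem_tangentSpace_of_tendstoUniformly (l := atTop) _
    (fun n => hmem _ (hBc n x) (hK n x)) (Eventually.of_forall fun n => ?_) ?_⟩
  · obtain ⟨A, hA⟩ := hB n
    exact hA.toLp_row_mem x i _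
  · rw [Metric.tendstoUniformly_iff]
    intro ε hε
    filter_upwards [Metric.tendstoUniformly_iff.1 (hlim x) ε hε] with n hn a
    rw [dist_eq_norm, ← row_sub]
    exact (norm_row_le _ i).trans_lt ((dist_eq_norm _ _).symm.trans_lt (hn a))

end Wass

end

/-! ### The limit theorem -/

theorem mainTheorem12 {d : ℕ} (μ : Wass.P2 d) (R : ℝ) (hR : 0 < R)
    (O : Set (Wass.P2 d)) (hO : O = Wass.ball μ R)
    (G : ℕ → Wass.P2 d → ℝ) (Glim : Wass.P2 d → ℝ)
    (hGcont : ∀ N, Continuous (G N))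
    (hGlim : TendstoUniformly G Glim atTop)
    -- `g N m` is `∇_w G_N[m]` and `B N m` is `∇²_w G_N[m]`
    (g : ℕ → Wass.P2 d → Wass.E d → Wass.E d)
    (B : ℕ → Wass.P2 d → Wass.E d → Wass.E d → Wass.E d →L[ℝ] Wass.E d)
    (hgrad : ∀ N, ∀ m ∈ O, Wass.HasGradAt (G N) m (g N m))
    (htwice : ∀ N, ∀ m ∈ O, Wass.HasSecondGradAt (G N) (g N) m (B N m))
    -- regularity and bounds
    (hgC1 : ∀ N, ∀ m ∈ O, ContDiff ℝ 1 (g N m))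
    (Cμ : ℝ) (hgrowth : ∀ N, ∀ m ∈ O, ∀ x, ‖g N m x‖ ≤ Cμ * (1 + ‖x‖))
    (hDgcont : ∀ N, ContinuousOn
      (fun p : Wass.E d × Wass.P2 d => fderiv ℝ (g N p.2) p.1) (univ ×ˢ O))
    (hDgbdd : ∀ N, ∃ K : ℝ, ∀ m ∈ O, ∀ x, ‖fderiv ℝ (g N m) x‖ ≤ K)
    (hBcont : ∀ N, ContinuousOn
      (fun p : (Wass.E d × Wass.E d) × Wass.P2 d => B N p.2 p.1.1 p.1.2) (univ ×ˢ O))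
    (hBbdd : ∃ K : ℝ, ∀ N, ∀ m ∈ O, ∀ x a, ‖B N m x a‖ ≤ K)
    -- quadratic Taylor bounds, uniform in `N`
    (C : Wass.P2 d → ℝ)
    (hTaylor1 : ∀ N, ∀ m ∈ O, ∀ ν ∈ O, ∀ γ ∈ Wass.optCouplings m ν,
      |G N ν - G N m - Wass.pairing (g N m) γ| ≤ C m * Wass.W2 m ν ^ 2)
    (hTaylor2 : ∀ N, ∀ m ∈ O, ∀ ν ∈ O, ∀ γ ∈ Wass.optCouplings m ν, ∀ x y,
      ‖g N ν y - g N m x - Wass.linPart (fderiv ℝ (g N m)) (B N m) γ x y‖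
        ≤ C m * (‖x - y‖ ^ 2 + Wass.W2 m ν ^ 2))
    -- uniform convergence of the derivatives
    (A : Wass.P2 d → Wass.E d → Wass.E d)
    (At : Wass.P2 d → Wass.E d → Wass.E d →L[ℝ] Wass.E d)
    (A2 : Wass.P2 d → Wass.E d → Wass.E d → Wass.E d →L[ℝ] Wass.E d)
    (ha : TendstoUniformlyOn (fun N (p : Wass.E d × Wass.P2 d) => g N p.2 p.1)
      (fun p => A p.2 p.1) atTop (univ ×ˢ O))
    (hb : TendstoUniformlyOn (fun N (p : Wass.E d × Wass.P2 d) => fderiv ℝ (g N p.2) p.1)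
      (fun p => At p.2 p.1) atTop (univ ×ˢ O))
    (hc : TendstoUniformlyOn
      (fun N (p : (Wass.E d × Wass.E d) × Wass.P2 d) => B N p.2 p.1.1 p.1.2)
      (fun p => A2 p.2 p.1.1 p.1.2) atTop (univ ×ˢ O)) :
    (∀ m ∈ O, Wass.HasGradAt Glim m (A m)) ∧
    Wass.TwiceContDiffOn Glim O A At A2 ∧
    (∀ m ∈ O, (∀ x, HasFDerivAt (A m) (At m x) x) ∧
      Wass.HasExpansion Glim O A m (At m) (A2 m) ∧
      Wass.HasSecondGradAt Glim A m (A2 m)) := by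
  have hOo : IsOpen O := hO ▸ Wass.isOpen_ball μ R
  obtain ⟨K, hK⟩ := hBbdd
  have hgc : ∀ N, ∀ m ∈ O, Continuous (g N m) := fun N m hm => (hgC1 N m hm).continuous
  have hsect : ∀ {m}, m ∈ O → ∀ x : Wass.E d, (x, m) ∈ (univ ×ˢ O : Set (Wass.E d × Wass.P2 d)) :=
    fun hm x => ⟨mem_univ _, hm⟩
  have hsect2 : ∀ {m}, m ∈ O → ∀ x a : Wass.E d, ((x, a), m) ∈
      (univ ×ˢ O : Set ((Wass.E d × Wass.E d) × Wass.P2 d)) := fun hm x a => ⟨mem_univ _, hm⟩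
  have hga : ∀ m ∈ O, ∀ x, Tendsto (fun N => g N m x) atTop (𝓝 (A m x)) := fun m hm x =>
    ha.tendsto_at (hsect hm x)
  have hDa : ∀ m ∈ O, ∀ x, Tendsto (fun N => fderiv ℝ (g N m) x) atTop (𝓝 (At m x)) :=
    fun m hm x => hb.tendsto_at (hsect hm x)
  have hBa : ∀ m ∈ O, ∀ x a, Tendsto (fun N => B N m x a) atTop (𝓝 (A2 m x a)) :=
    fun m hm x a => hc.tendsto_at (hsect2 hm x a)
  have hau : ∀ m ∈ O, TendstoUniformly (fun N => g N m) (A m) atTop := fun m hm =>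
    Wass.tendstoUniformly_section ha (fun x => (x, m)) (hsect hm)
  have hbu : ∀ m ∈ O, TendstoUniformly (fun N => fderiv ℝ (g N m)) (At m) atTop := fun m hm =>
    Wass.tendstoUniformly_section hb (fun x => (x, m)) (hsect hm)
  have hcu : ∀ m ∈ O, ∀ x, TendstoUniformly (fun N => B N m x) (A2 m x) atTop := fun m hm x =>
    Wass.tendstoUniformly_section hc (fun a => ((x, a), m)) (hsect2 hm x)
  have hBc : ∀ N, ∀ m ∈ O, ∀ x, Continuous (B N m x) := fun N m hm x =>
    (hBcont N).comp_continuous (f := fun a => ((x, a), m)) (by fun_prop) (hsect2 hm x)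
  have hAtc : ContinuousOn (fun p : Wass.E d × Wass.P2 d => At p.2 p.1) (univ ×ˢ O) :=
    hb.continuousOn (Frequently.of_forall hDgcont)
  have hA2c : ContinuousOn (fun p : (Wass.E d × Wass.E d) × Wass.P2 d => A2 p.2 p.1.1 p.1.2)
      (univ ×ˢ O) := hc.continuousOn (Frequently.of_forall hBcont)
  have hAgrowth : ∀ m ∈ O, ∀ x, ‖A m x‖ ≤ Cμ * (1 + ‖x‖) := fun m hm x =>
    le_of_tendsto (hga m hm x).norm (Eventually.of_forall fun N => hgrowth N m hm x)
  have hA2K : ∀ m ∈ O, ∀ x a, ‖A2 m x a‖ ≤ K := fun m hm x a =>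
    le_of_tendsto (hBa m hm x a).norm (Eventually.of_forall fun N => hK N m hm x a)
  -- Uniform convergence of the derivatives together with pointwise convergence of the fields
  -- identifies the derivative of the limit.
  have hAd : ∀ m ∈ O, ∀ x, HasFDerivAt (A m) (At m x) x := fun m hm x =>
    hasFDerivAt_of_tendstoUniformly (hbu m hm)
      (fun N x => ((hgC1 N m hm).differentiable one_ne_zero x).hasFDerivAt) (hga m hm) x
  have hAcont : ∀ m ∈ O, Continuous (A m) := fun m hm =>
    (show Differentiable ℝ (A m) from fun x => (hAd m hm x).differentiableAt).continuous
  -- symmetry of the spatial derivative, hence tangency of the gradient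
  have hsymm : ∀ m ∈ O, ∀ x u w, inner ℝ (At m x u) w = inner ℝ (At m x w) u := by
    intro m hm x u w
    have hlim : ∀ v v' : Wass.E d, Tendsto (fun N => (inner ℝ (fderiv ℝ (g N m) x v) v' : ℝ)) atTop
        (𝓝 (inner ℝ (At m x v) v')) := fun v v' =>
      (Wass.tendsto_clm_apply_const (hDa m hm x) v).inner tendsto_const_nhds
    refine tendsto_nhds_unique ((hlim u w).congr fun N => ?_) (hlim w u)
    exact Wass.symmetric_of_taylor (D := fun m => fderiv ℝ (g N m)) hOo (hgc N) (hTaylor1 N)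
      (hDgcont N) (hBc N) (hK N) (hTaylor2 N) hm x u w
  have hAmem : ∀ m ∈ O, MemLp (A m) 2 m.meas := fun m hm =>
    Wass.memLp_of_linear_growth m (hAcont m hm) (hAgrowth m hm)
  have hAT : ∀ m (hm : m ∈ O), (hAmem m hm).toLp (A m) ∈ Wass.tangentSpace m := by
    intro m hm
    obtain ⟨ψ, hψ⟩ := Wass.exists_hasGradientAt_of_symmetric
      (fun x => (hAd m hm x).differentiableAt) (fun x u w => by
        rw [(hAd m hm x).fderiv]
        exact hsymm m hm x u w)
    exact Wass.toLp_mem_tangentSpace_of_hasGradientAt (hAcont m hm) hψ (hAgrowth m hm) _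
  have happrox : ∀ m ∈ O, Wass.HasQuadraticApprox Glim m (A m) := by
    intro m hm
    refine ⟨C m, ?_⟩
    filter_upwards [hOo.mem_nhds hm] with ν hν γ hγ
    have h1 := ((hGlim.tendsto_at ν).sub (hGlim.tendsto_at m)).sub
      (Wass.tendsto_pairing hγ.1 (fun N => hgc N m hm) (fun N => hgrowth N m hm) (hga m hm))
    exact le_of_tendsto h1.abs (Eventually.of_forall fun N => hTaylor1 N m hm ν hν γ hγ)
  have hgradA : ∀ m ∈ O, Wass.HasGradAt Glim m (A m) := fun m hm =>
    (happrox m hm).hasGradAt (hAmem m hm) (hAT m hm)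
  have hexp : ∀ m ∈ O, Wass.HasExpansion Glim O A m (At m) (A2 m) := by
    intro m hm
    refine ⟨hOo.mem_nhds hm, hgradA, hAcont, ⟨Cμ, hAgrowth⟩, ?_, ?_, ?_, ⟨K, hA2K m hm⟩, ?_⟩
    · exact (hAtc.comp_continuous (f := fun x => (x, m)) (by fun_prop) (hsect hm)).measurable
    -- The bounds on the spatial derivatives may depend on `N`; a single `N` within distance 1 of
    -- `At m` is enough.
    · obtain ⟨N, hN⟩ := (Metric.tendstoUniformly_iff.1 (hbu m hm) 1 one_pos).exists
      obtain ⟨K', hK'⟩ := hDgbdd N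
      refine ⟨1 + K', fun x => ?_⟩
      have h1 := norm_le_norm_sub_add (At m x) (fderiv ℝ (g N m) x)
      rw [← dist_eq_norm] at h1
      linarith [hN x, hK' m hm x]
    · exact (hA2c.comp_continuous (f := fun p : Wass.E d × Wass.E d => (p, m)) (by fun_prop)
        (fun p => hsect2 hm p.1 p.2)).measurable
    · obtain ⟨ρ, ε₂, hρ, hε0, hε, hle⟩ := Wass.exists_moduli_of_quadratic_bound (C m)
      refine ⟨ρ, ε₂, hρ, hε0, hε, fun ν hν γ hγ x y => le_trans ?_ (hle _ _)⟩
      have h1 := ((hga ν hν y).sub (hga m hm x)).sub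
        (Wass.tendsto_linPart hγ.1 (D := fun N => fderiv ℝ (g N m)) (D' := At m)
          (B := fun N => B N m) (B' := A2 m) (hDa m hm x) (fun N => hBc N m hm x)
          (fun N => hK N m hm x) (hBa m hm x) y)
      exact le_of_tendsto h1.norm
        (Eventually.of_forall fun N => hTaylor2 N m hm ν hν γ hγ x y)
  -- The limit field is its own projection, so `A2 m` serves both as coefficient of the expansion
  -- and as second order gradient.
  have hproj : ∀ m ∈ O, Wass.IsTangentProj m (A2 m) (A2 m) := fun m hm =>
    Wass.isTangentProj_of_tendstoUniformly (fun N => by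
      obtain ⟨_, _, A', _, h⟩ := htwice N m hm
      exact ⟨A', h⟩) (fun N => hBc N m hm) (fun N => hK N m hm) (hcu m hm)
  exact ⟨hgradA, ⟨fun m hm => ⟨O, A2 m, hexp m hm, hproj m hm⟩, hAtc, hA2c⟩, fun m hm =>
    ⟨hAd m hm, hexp m hm, O, At m, A2 m, hexp m hm, hproj m hm⟩⟩
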